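/- For a Young diagram $\lambda$ with $n$ boxes and $\pi\in S_l$, let $$\Sigma^\lambda(\pi)=n(n-1)\cdots(n-l+1)\,\frac{\operatorname{Tr}\rho^\lambda(\pi)}{\operatorname{Tr}\rho^\lambda(e)}$$ be the normalized character, where $\rho^\lambda$ is the irreducible representation of $S_n$ of shape $\lambda$ and $\pi$ is regarded as an element of $S_n$ by adding fixed points ($\Sigma^\lambda(\pi)=0$ if $l>n$). Let $T_\lambda=(t_{ij})$ be the random matrix with independent entries such that $t_{ij}$ is a centered complex Gaussian variable with $\mathbb{E}|t_{ij}|^2=1$, $\mathbb{E}\,t_{ij}^2=0$ if $\lambda$ has a box in column $i$ and row $j$, and $t_{ij}=0$ otherwise. For $\mathbf p=(p_1,\dots,p_m)$, $\mathbf q=(q_1,\dots,q_m)$ positive integers with $q_1\ge\dots\ge q_m$, let $\mathbf p\times\mathbf q$ be the multirectangular Young diagram which has $p_1$ rows of length $q_1$, then $p_2$ rows of length $q_2$, and so on. **Theorem.** Fix $m,l\ge 0$ and $\pi\in S_l$, and let $k_1,\dots,k_r$ be the lengths of all cycles of $\pi$ (fixed points included). There is a unique polynomial $S_\pi\in\mathbb{C}[p_1,\dots,p_m,q_1,\dots,q_m]$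 whose value is $\Sigma^{\mathbf p\times\mathbf q}(\pi)$ for every multirectangular Young diagram $\mathbf p\times\mathbf q$ as above. There is a unique polynomial $M_\pi\in\mathbb{C}[p_1,\dots,p_m,q_1,\dots,q_m]$ whose value is $$\mathbb{E}\big(\operatorname{Tr}(T_\lambda T_\lambda^\star)^{k_1}\cdots\operatorname{Tr}(T_\lambda T_\lambda^\star)^{k_r}\big),\qquad \lambda=\mathbf p\times\mathbf q,$$ (this expectation exists) for every such $\mathbf p\times\mathbf q$. These polynomials define both quantities for arbitrary $\mathbf p,\mathbf q\in\mathbb{C}^m$ (formal Young diagrams $\mathbf p\times\mathbf q$), and $$S_\pi(\mathbf p,\mathbf q)=(-1)^l\,M_\pi(\mathbf p,-\mathbf q)\qquad\text{for all }\mathbf p,\mathbf q\in\mathbb{C}^m,$$ that is, $\Sigma^{\mathbf p\times\mathbf q}(\pi)=(-1)^l\,\mathbb{E}\big(\prod_{i}\operatorname{Tr}(T_{\mathbf p\times(-\mathbf q)}T_{\mathbf p\times(-\mathbf q)}^\star)^{k_i}\big)$ for every formal Young diagram $\mathbf p\times\mathbf q$. -/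

import Mathlib

open MeasureTheory ProbabilityTheory Matrix

noncomputable section

/-! ### Young diagrams and normalized characters

In a `YoungDiagram` the cell `(i, j)` lies in row `i` and column `j` (both counted from `0`). -/

/-- Permutations of the boxes of `lam`. -/
abbrev BoxPerm (lam : YoungDiagram) : Type := Equiv.Perm lam.cells

/-- The complex group algebra of the group of permutations of the boxes of `lam`. -/
abbrev BoxAlgebra (lam : YoungDiagram) : Type := MonoidAlgebra ℂ (BoxPerm lam)

open Classical in
/-- `a_lam`: the sum of all permutations of the boxes which preserve each row. -/
def rowSymmetrizer (lam : YoungDiagram) : BoxAlgebra lam :=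
  ∑ σ : BoxPerm lam with ∀ x, (σ x).1.1 = x.1.1, MonoidAlgebra.single σ 1

open Classical in
/-- `b_lam`: the signed sum of all permutations of the boxes which preserve each column. -/
def columnAntisymmetrizer (lam : YoungDiagram) : BoxAlgebra lam :=
  ∑ σ : BoxPerm lam with ∀ x, (σ x).1.2 = x.1.2,
    MonoidAlgebra.single σ ((Equiv.Perm.sign σ : ℤ) : ℂ)

/-- The space of the irreducible representation of shape `lam`: the left ideal of the group algebra
generated by the Young symmetrizer `b_lam * a_lam`. -/
abbrev spechtSpace (lam : YoungDiagram) : Submodule (BoxAlgebra lam) (BoxAlgebra lam) :=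
  Submodule.span (BoxAlgebra lam) {columnAntisymmetrizer lam * rowSymmetrizer lam}

/-- The irreducible representation of shape `lam`: left multiplication on `spechtSpace lam`. -/
def spechtRep (lam : YoungDiagram) : Representation ℂ (BoxPerm lam) (spechtSpace lam) :=
  (Algebra.lsmul ℂ ℂ (spechtSpace lam) :
      BoxAlgebra lam →ₐ[ℂ] Module.End ℂ (spechtSpace lam)).toMonoidHom.comp
    (MonoidAlgebra.of ℂ (BoxPerm lam))

/-- A permutation `π ∈ S_l` regarded as an element of `S_n` for `n ≥ l` (the additional points are
fixed) and then, through an enumeration of the boxes, as a permutation of the `n` boxes of `lam`.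
Its conjugacy class does not depend on the enumeration. -/
def toBoxPerm (lam : YoungDiagram) {l : ℕ} (h : l ≤ lam.card) (π : Equiv.Perm (Fin l)) :
    BoxPerm lam :=
  lam.cells.equivFin.symm.permCongr (π.viaEmbedding (Fin.castLEEmb h))

/-- The normalized character `Σ^lam(π) = (n)_l Tr ρ(π) / Tr ρ(e)` for `π ∈ S_l`, where `n` is the
number of boxes of `lam` and `(n)_l = n (n - 1) ⋯ (n - l + 1)`. For `l > n` the falling factorial
`(n)_l` vanishes and the value is `0`. -/
def normalizedCharacter (lam : YoungDiagram) {l : ℕ} (π : Equiv.Perm (Fin l)) : ℂ :=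
  if h : l ≤ lam.card then
    (lam.card.descFactorial l : ℂ) *
      ((spechtRep lam).character (toBoxPerm lam h π) / (spechtRep lam).character 1)
  else 0

/-! ### Multirectangular diagrams -/

/-- The list of row lengths `q 0, …, q 0, q 1, …, q 1, …`, where `q i` is repeated `p i` times. -/
def multirectList {m : ℕ} (p q : Fin m → ℕ) : List ℕ :=
  (List.ofFn fun i => List.replicate (p i) (q i)).flatten

theorem multirectList_sortedGE {m : ℕ} (p : Fin m → ℕ) {q : Fin m → ℕ} (hq : Antitone q) :
    (multirectList p q).SortedGE := by
  rw [List.sortedGE_iff_pairwise, multirectList, List.pairwise_flatten]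
  refine ⟨?_, ?_⟩
  · intro L hL
    obtain ⟨i, rfl⟩ := (List.mem_ofFn' _ _).1 hL
    rw [List.pairwise_replicate]
    exact Or.inr le_rfl
  · rw [List.pairwise_ofFn]
    intro i j hij x hx y hy
    rw [List.eq_of_mem_replicate hx, List.eq_of_mem_replicate hy]
    exact hq hij.le

/-- The multirectangular Young diagram `p × q`. -/
def multirect {m : ℕ} (p q : Fin m → ℕ) (hq : Antitone q) : YoungDiagram :=
  YoungDiagram.ofRowLens (multirectList p q) (multirectList_sortedGE p hq)

/-! ### The Gaussian random matrix of a Young diagram -/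

/-- The law of a standard complex centered Gaussian variable `t`: the real and imaginary parts are
independent centered real Gaussians of variance `1/2`, so `E t = 0`, `E |t|² = 1`, `E t² = 0`. -/
def stdComplexGaussian : Measure ℂ :=
  ((gaussianReal 0 (1 / 2)).prod (gaussianReal 0 (1 / 2))).map
    fun z : ℝ × ℝ => (⟨z.1, z.2⟩ : ℂ)

/-- The joint law of the entries of `T_lam` at the boxes of `lam`: independent standard complex
Gaussians. -/
def entryLaw (lam : YoungDiagram) : Measure (lam.cells → ℂ) :=
  Measure.pi fun _ => stdComplexGaussian

/-- A common bound for the number of columns and the number of rows of `lam`. -/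
def diagramSize (lam : YoungDiagram) : ℕ := max (lam.rowLen 0) (lam.colLen 0)

/-- The matrix `T_lam` as a function of the entries `t` at the boxes of `lam`, truncated to a
square matrix which contains all boxes. The entry in place `(i, j)` belongs to the box in column
`i` and row `j` of `lam`; it is `0` if there is no such box. -/
def bandMatrix (lam : YoungDiagram) (t : lam.cells → ℂ) :
    Matrix (Fin (diagramSize lam)) (Fin (diagramSize lam)) ℂ :=
  Matrix.of fun i j =>
    if h : ((j : ℕ), (i : ℕ)) ∈ lam.cells then t ⟨((j : ℕ), (i : ℕ)), h⟩ else 0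

/-- `Tr (T T*)^{k_1} ⋯ Tr (T T*)^{k_r}`, where `k_1, …, k_r` are the lengths of all cycles of `π`
(fixed points are cycles of length `1`). -/
def traceProduct (lam : YoungDiagram) {l : ℕ} (π : Equiv.Perm (Fin l)) (t : lam.cells → ℂ) : ℂ :=
  (π.partition.parts.map fun k => ((bandMatrix lam t * (bandMatrix lam t)ᴴ) ^ k).trace).prod

/-! ### Formal diagrams

Polynomials in the `2 m` variables `p_1, …, p_m, q_1, …, q_m`; the left summand of
`Fin m ⊕ Fin m` indexes the variables `p`, the right one the variables `q`. -/

/-- `S(p, q) = Σ^{p × q}(π)` for every multirectangular Young diagram `p × q` with `m` blocks. -/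
def IsCharacterPolynomial {m l : ℕ} (π : Equiv.Perm (Fin l))
    (S : MvPolynomial (Fin m ⊕ Fin m) ℂ) : Prop :=
  ∀ (p q : Fin m → ℕ) (hq : Antitone q), (∀ i, 0 < p i) → (∀ i, 0 < q i) →
    MvPolynomial.eval (Sum.elim (fun i => (p i : ℂ)) (fun i => (q i : ℂ))) S =
      normalizedCharacter (multirect p q hq) π

/-- `M(p, q) = E (Tr (T T*)^{k_1} ⋯ Tr (T T*)^{k_r})` with `T = T_{p × q}` for every
multirectangular Young diagram `p × q` with `m` blocks, where the expectation exists. -/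
def IsMomentPolynomial {m l : ℕ} (π : Equiv.Perm (Fin l))
    (M : MvPolynomial (Fin m ⊕ Fin m) ℂ) : Prop :=
  ∀ (p q : Fin m → ℕ) (hq : Antitone q), (∀ i, 0 < p i) → (∀ i, 0 < q i) →
    Integrable (traceProduct (multirect p q hq) π) (entryLaw (multirect p q hq)) ∧
      MvPolynomial.eval (Sum.elim (fun i => (p i : ℂ)) (fun i => (q i : ℂ))) M =
        ∫ t, traceProduct (multirect p q hq) π t ∂(entryLaw (multirect p q hq))

end

/-!
Both sides are sums over the permutations `σ` of the number of ways to place `l` boxes in the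
diagram such that the columns are constant along the cycles of `σ` and the rows along those of
`σ⁻¹ π⁻¹`. For the character (Stanley, Féray), where each number carries the sign of `σ`, this
comes from expanding the Young symmetrizer, an idempotent up to a scalar which generates the
irreducible representation; for the moments, where there is no sign, it is Wick's formula.
On `p × q` this number is a polynomial, homogeneous of degree the number `c` of cycles of `σ` in
the variables `q`: a cycle of `σ` which visits rows of several blocks can take as its column any of
the columns of the shortest row. Hence the passage from `q` to `-q` multiplies it by `(-1) ^ c`,
and `sign σ = (-1) ^ (l + c)`.
-/

section FiberPerms

variable {α β γ : Type*}

/-- The Young subgroup of `f`: the permutations which preserve every fiber of `f`. For `f` the row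
(column) of a box of a Young diagram, these are the row (column) permutations. -/
def fiberPerms (f : α → β) : Subgroup (Equiv.Perm α) where
  carrier := {σ | ∀ x, f (σ x) = f x}
  mul_mem' := fun {σ τ} hσ hτ x => by rw [Equiv.Perm.mul_apply, hσ, hτ]
  one_mem' := fun _ => rfl
  inv_mem' := fun {σ} hσ x => by
    rw [← hσ, ← Equiv.Perm.mul_apply, mul_inv_cancel, Equiv.Perm.one_apply]

theorem mem_fiberPerms {f : α → β} {σ : Equiv.Perm α} :
    σ ∈ fiberPerms f ↔ ∀ x, f (σ x) = f x :=
  Iff.rfl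

theorem fiberPerms_comp_of_injective {g : β → γ} (hg : Function.Injective g) (f : α → β) :
    fiberPerms (g ∘ f) = fiberPerms f := by
  ext σ
  simp only [mem_fiberPerms, Function.comp_apply, hg.eq_iff]

theorem swap_mem_fiberPerms [DecidableEq α] {f : α → β} {x y : α} (h : f x = f y) :
    Equiv.swap x y ∈ fiberPerms f := by
  intro z
  rw [Equiv.swap_apply_def]
  split_ifs with hx hy
  · rw [hx, h]
  · rw [hy, h]
  · rfl

theorem disjoint_fiberPerms {r : α → β} {c : α → γ}
    (h : Function.Injective fun x => (r x, c x)) : Disjoint (fiberPerms c) (fiberPerms r) :=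
  Subgroup.disjoint_def.2 fun hc hr => Equiv.ext fun x => h (Prod.ext (hr x) (hc x))

theorem viaEmbedding_mem_fiberPerms {c : β → γ} {f : α ↪ β} {σ : Equiv.Perm α} :
    σ.viaEmbedding f ∈ fiberPerms c ↔ σ ∈ fiberPerms (c ∘ f) := by
  refine ⟨fun h i => ?_, fun h x => ?_⟩
  · rw [Function.comp_apply, ← Equiv.Perm.viaEmbedding_apply, h, Function.comp_apply]
  by_cases hx : x ∈ Set.range f
  · obtain ⟨i, rfl⟩ := hx
    rw [Equiv.Perm.viaEmbedding_apply]
    exact h i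
  · rw [Equiv.Perm.viaEmbedding_apply_of_notMem _ _ _ hx]

end FiberPerms

section ViaEmbedding

variable {α β γ : Type*}

theorem eq_viaEmbedding {σ : Equiv.Perm α} {f : α ↪ β} {ρ : Equiv.Perm β}
    (h : ∀ a, ρ (f a) = f (σ a)) (h' : ∀ b ∉ Set.range f, ρ b = b) : ρ = σ.viaEmbedding f := by
  ext b
  by_cases hb : b ∈ Set.range f
  · obtain ⟨a, rfl⟩ := hb
    rw [h, Equiv.Perm.viaEmbedding_apply]
  · rw [h' b hb, Equiv.Perm.viaEmbedding_apply_of_notMem _ _ _ hb]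

theorem exists_eq_viaEmbedding {f : α ↪ β} {ρ : Equiv.Perm β} (h : ∀ b ∉ Set.range f, ρ b = b) :
    ∃ σ : Equiv.Perm α, σ.viaEmbedding f = ρ := by
  have hρ : ∀ b, ρ b ∈ Set.range f ↔ b ∈ Set.range f := by
    intro b
    refine not_iff_not.1 ⟨fun hb hb' => hb ?_, fun hb => by rwa [h b hb]⟩
    rwa [ρ.injective (h _ hb)]
  let e := Equiv.ofInjective f f.injective
  refine ⟨e.symm.permCongr (ρ.subtypePerm hρ), (eq_viaEmbedding (fun a => ?_) h).symm⟩
  exact (congrArg Subtype.val (e.apply_symm_apply (ρ.subtypePerm hρ (e a)))).symm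

theorem permCongr_viaEmbedding (σ : Equiv.Perm α) (f : α ↪ β) (e : β ≃ γ) :
    e.permCongr (σ.viaEmbedding f) = σ.viaEmbedding (f.trans e.toEmbedding) := by
  refine eq_viaEmbedding (fun a => ?_) fun b hb => ?_
  · simp [Equiv.Perm.viaEmbedding_apply]
  · rw [Equiv.permCongr_apply, Equiv.Perm.viaEmbedding_apply_of_notMem, Equiv.apply_symm_apply]
    rintro ⟨a, ha⟩
    exact hb ⟨a, by simp [ha]⟩

theorem conj_viaEmbedding (σ : Equiv.Perm α) (f : α ↪ β) (g : Equiv.Perm β) :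
    g * σ.viaEmbedding f * g⁻¹ = σ.viaEmbedding (g • f) := by
  rw [← Equiv.permCongr_eq_mul]
  exact permCongr_viaEmbedding σ f g

theorem sign_viaEmbedding [Fintype α] [DecidableEq α] [Fintype β] [DecidableEq β]
    (σ : Equiv.Perm α) (f : α ↪ β) :
    Equiv.Perm.sign (σ.viaEmbedding f) = Equiv.Perm.sign σ := by
  rw [Equiv.Perm.viaEmbedding]
  convert! Equiv.Perm.sign_extendDomain σ (Equiv.ofInjective f.1 f.2)

end ViaEmbedding

section SubgroupSum

variable {k G : Type*} [CommRing k] [Group G] [Fintype G] {H K : Subgroup G} {χ ψ : G →* k}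

variable (H χ) in
/-- The element `∑ g ∈ H, χ(g) g` of the group algebra. The row symmetrizer and the column
antisymmetrizer of a Young diagram are of this form. -/
noncomputable def subgroupSum : MonoidAlgebra k G :=
  ∑ g, MonoidAlgebra.single g ((H : Set G).indicator χ g)

theorem coeff_subgroupSum (g : G) : (subgroupSum H χ).coeff g = (H : Set G).indicator χ g := by
  classical
  simp [subgroupSum, MonoidAlgebra.coeff_sum, Finset.sum_apply', Finsupp.single_apply]

theorem subgroupSum_mul_single {h : G} (hh : h ∈ H) :
    subgroupSum H χ * MonoidAlgebra.single h (χ h) = subgroupSum H χ := by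
  ext g
  rw [MonoidAlgebra.coeff_mul_single_apply, coeff_subgroupSum, coeff_subgroupSum]
  by_cases hg : g ∈ H
  · rw [Set.indicator_of_mem (H.mul_mem hg (H.inv_mem hh)), Set.indicator_of_mem hg, ← map_mul,
      inv_mul_cancel_right]
  · rw [Set.indicator_of_notMem, Set.indicator_of_notMem hg, zero_mul]
    exact fun h' => hg ((H.mul_mem_cancel_right (H.inv_mem hh)).1 h')

theorem single_mul_subgroupSum {h : G} (hh : h ∈ H) :
    MonoidAlgebra.single h (χ h) * subgroupSum H χ = subgroupSum H χ := by
  ext g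
  rw [MonoidAlgebra.coeff_single_mul_apply, coeff_subgroupSum, coeff_subgroupSum]
  by_cases hg : g ∈ H
  · rw [Set.indicator_of_mem (H.mul_mem (H.inv_mem hh) hg), Set.indicator_of_mem hg, ← map_mul,
      mul_inv_cancel_left]
  · rw [Set.indicator_of_notMem, Set.indicator_of_notMem hg, mul_zero]
    exact fun h' => hg ((H.mul_mem_cancel_left (H.inv_mem hh)).1 h')

theorem coeff_subgroupSum_mul_subgroupSum (g : G) :
    (subgroupSum H χ * subgroupSum K ψ).coeff g =
      ∑ σ, (H : Set G).indicator χ σ * (K : Set G).indicator ψ (σ⁻¹ * g) := by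
  conv_lhs => rw [subgroupSum, Finset.sum_mul]
  simp only [MonoidAlgebra.coeff_sum, Finset.sum_apply', MonoidAlgebra.coeff_single_mul_apply,
    coeff_subgroupSum]

theorem coeff_one_subgroupSum_mul_subgroupSum (h : Disjoint H K) :
    (subgroupSum H χ * subgroupSum K ψ).coeff 1 = 1 := by
  rw [coeff_subgroupSum_mul_subgroupSum, Finset.sum_eq_single 1]
  · rw [inv_one, one_mul, Set.indicator_of_mem H.one_mem, Set.indicator_of_mem K.one_mem, map_one,
      map_one, one_mul]
  · intro σ _ hσ
    rw [mul_one]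
    by_cases hH : σ ∈ H
    · rw [Set.indicator_of_notMem (s := (K : Set G)), mul_zero]
      exact fun hK => hσ (Subgroup.disjoint_def.1 h hH (K.inv_mem_iff.1 hK))
    · rw [Set.indicator_of_notMem (s := (H : Set G)) hH, zero_mul]
  · exact fun h => absurd (Finset.mem_univ _) h

theorem subgroupSum_mul_single_mul_subgroupSum_eq_smul {σ τ : G} (hσ : σ ∈ H) (hτ : τ ∈ K) :
    subgroupSum H χ * MonoidAlgebra.single (σ * τ) 1 * subgroupSum K ψ =
      (χ σ⁻¹ * ψ τ⁻¹) • (subgroupSum H χ * subgroupSum K ψ) := by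
  have hfactor : MonoidAlgebra.single (σ * τ) (1 : k) =
      (χ σ⁻¹ * ψ τ⁻¹) • (MonoidAlgebra.single σ (χ σ) * MonoidAlgebra.single τ (ψ τ)) := by
    rw [MonoidAlgebra.single_mul_single, MonoidAlgebra.smul_single, smul_eq_mul, mul_mul_mul_comm,
      ← map_mul, ← map_mul, inv_mul_cancel, inv_mul_cancel, map_one, map_one, one_mul]
  rw [hfactor, mul_smul_comm, smul_mul_assoc, ← mul_assoc, subgroupSum_mul_single hσ, mul_assoc,
    single_mul_subgroupSum hτ]

theorem subgroupSum_mul_single_mul_subgroupSum_eq_zero [IsDomain k] {g s t : G} (hs : s ∈ H)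
    (ht : t ∈ K) (hst : s * g = g * t) (hne : χ s ≠ ψ t) :
    subgroupSum H χ * MonoidAlgebra.single g 1 * subgroupSum K ψ = 0 := by
  have hsingle : MonoidAlgebra.single s (χ s) * MonoidAlgebra.single g (ψ t) =
      χ s • (MonoidAlgebra.single g (1 : k) * MonoidAlgebra.single t (ψ t)) := by
    rw [MonoidAlgebra.single_mul_single, MonoidAlgebra.single_mul_single,
      MonoidAlgebra.smul_single, hst, one_mul, smul_eq_mul]
  have hsmul : χ s • (subgroupSum H χ * MonoidAlgebra.single g 1 * subgroupSum K ψ) =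
      ψ t • (subgroupSum H χ * MonoidAlgebra.single g 1 * subgroupSum K ψ) := by
    calc _ = subgroupSum H χ * (χ s • (MonoidAlgebra.single g (1 : k) *
            MonoidAlgebra.single t (ψ t))) * subgroupSum K ψ := by
          rw [mul_smul_comm, smul_mul_assoc, ← mul_assoc,
            mul_assoc _ (MonoidAlgebra.single t _), single_mul_subgroupSum ht]
      _ = subgroupSum H χ * MonoidAlgebra.single g (ψ t) * subgroupSum K ψ := by
          rw [← hsingle, ← mul_assoc, subgroupSum_mul_single hs]
      _ = _ := by
          rw [← smul_mul_assoc, ← mul_smul_comm, MonoidAlgebra.smul_single, smul_eq_mul, mul_one]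
  ext x
  have hcoeff := congrArg (fun y => y.coeff x) hsmul
  simp only [MonoidAlgebra.coeff_smul, Finsupp.smul_apply, smul_eq_mul] at hcoeff
  exact (mul_eq_mul_right_iff.1 hcoeff).resolve_left hne

theorem exists_subgroupSum_mul_subgroupSum_mul_self [IsDomain k]
    (h : ∀ g, (∃ σ ∈ H, ∃ τ ∈ K, g = σ * τ) ∨
      ∃ s ∈ H, ∃ t ∈ K, s * g = g * t ∧ χ s ≠ ψ t) :
    ∃ a : k, (subgroupSum H χ * subgroupSum K ψ) * (subgroupSum H χ * subgroupSum K ψ) =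
      a • (subgroupSum H χ * subgroupSum K ψ) := by
  have hspan : ∀ x : MonoidAlgebra k G,
      ∃ a : k, subgroupSum H χ * x * subgroupSum K ψ = a • (subgroupSum H χ * subgroupSum K ψ) := by
    intro x
    induction x using MonoidAlgebra.induction_linear with
    | zero => exact ⟨0, by rw [mul_zero, zero_mul, zero_smul]⟩
    | add x y hx hy =>
      obtain ⟨a, ha⟩ := hx
      obtain ⟨b, hb⟩ := hy
      exact ⟨a + b, by rw [mul_add, add_mul, ha, hb, add_smul]⟩
    | single g c =>
      have hc : MonoidAlgebra.single g c = c • MonoidAlgebra.single g (1 : k) := by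
        rw [MonoidAlgebra.smul_single, smul_eq_mul, mul_one]
      rw [hc, mul_smul_comm, smul_mul_assoc]
      rcases h g with ⟨σ, hσ, τ, hτ, rfl⟩ | ⟨s, hs, t, ht, hst, hne⟩
      · exact ⟨_, by rw [subgroupSum_mul_single_mul_subgroupSum_eq_smul hσ hτ, smul_smul]⟩
      · exact ⟨0, by rw [subgroupSum_mul_single_mul_subgroupSum_eq_zero hs ht hst hne, smul_zero,
          zero_smul]⟩
  obtain ⟨a, ha⟩ := hspan (subgroupSum K ψ * subgroupSum H χ)
  exact ⟨a, by simpa only [mul_assoc] using ha⟩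

end SubgroupSum

section YoungElement

variable {k α β γ δ : Type*} [CommRing k]

/-- The sign of permutations with values in a commutative ring. -/
noncomputable def signChar (k α : Type*) [CommRing k] [Fintype α] [DecidableEq α] :
    Equiv.Perm α →* k :=
  (Int.castRingHom k).toMonoidHom.comp ((Units.coeHom ℤ).comp Equiv.Perm.sign)

theorem signChar_apply [Fintype α] [DecidableEq α] (σ : Equiv.Perm α) :
    signChar k α σ = ((Equiv.Perm.sign σ : ℤ) : k) :=
  rfl

theorem signChar_swap [Fintype α] [DecidableEq α] {x y : α} (h : x ≠ y) :
    signChar k α (Equiv.swap x y) = -1 := by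
  rw [signChar_apply, Equiv.Perm.sign_swap h, Units.val_neg, Units.val_one, Int.cast_neg,
    Int.cast_one]

variable (k) in
/-- The Young symmetrizer of a set of boxes with rows `r` and columns `c`: the product of the
signed sum of the column permutations and the sum of the row permutations. Neither map has to be
injective, so that the boxes of a Young diagram may be relabelled or repeated. -/
noncomputable def youngElement [Fintype α] [DecidableEq α] (r : α → γ) (c : α → δ) :
    MonoidAlgebra k (Equiv.Perm α) :=
  subgroupSum (fiberPerms c) (signChar k α) * subgroupSum (fiberPerms r) 1

theorem youngElement_eq_zero [IsDomain k] [CharZero k] [Fintype α] [DecidableEq α] {r : α → γ}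
    {c : α → δ} (h : ¬ Function.Injective fun x => (r x, c x)) : youngElement k r c = 0 := by
  obtain ⟨x, y, hxy, hne⟩ := Function.not_injective_iff.1 h
  obtain ⟨hr, hc⟩ := Prod.mk.inj hxy
  rw [youngElement, ← mul_one (subgroupSum (fiberPerms c) _)]
  refine subgroupSum_mul_single_mul_subgroupSum_eq_zero (swap_mem_fiberPerms hc)
    (swap_mem_fiberPerms hr) ((mul_one _).trans (one_mul _).symm) ?_
  rw [signChar_swap hne, MonoidHom.one_apply]
  norm_num

theorem exists_viaEmbedding_eq_of_mem_fiberPerms {r : β → γ} {c : β → δ}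
    (h : Function.Injective fun x => (r x, c x)) {f : α ↪ β} {ρ : Equiv.Perm α}
    {σ : Equiv.Perm β} (hc : σ ∈ fiberPerms c) (hr : σ⁻¹ * ρ.viaEmbedding f ∈ fiberPerms r) :
    ∃ τ : Equiv.Perm α, τ.viaEmbedding f = σ := by
  refine exists_eq_viaEmbedding fun x hx => ?_
  have hrow : r (σ⁻¹ x) = r x := by
    simpa only [Equiv.Perm.mul_apply, Equiv.Perm.viaEmbedding_apply_of_notMem _ _ _ hx] using hr x
  have hfix : σ⁻¹ x = x := h (Prod.ext hrow ((fiberPerms c).inv_mem hc x))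
  exact (Equiv.Perm.inv_eq_iff_eq.1 hfix).symm

variable [Fintype α] [DecidableEq α] [Fintype β]

theorem coeff_youngElement_viaEmbedding [DecidableEq β] {r : β → γ} {c : β → δ}
    (h : Function.Injective fun x => (r x, c x)) (ρ : Equiv.Perm α) (f : α ↪ β) :
    (youngElement k r c).coeff (ρ.viaEmbedding f) = (youngElement k (r ∘ f) (c ∘ f)).coeff ρ := by
  classical
  rw [youngElement, youngElement, coeff_subgroupSum_mul_subgroupSum,
    coeff_subgroupSum_mul_subgroupSum]
  refine (Fintype.sum_of_injective (Equiv.Perm.viaEmbeddingHom f)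
    (Equiv.Perm.viaEmbeddingHom_injective f) _ _ (fun σ hσ => ?_) fun σ => ?_).symm
  · by_contra hne
    exact hσ (exists_viaEmbedding_eq_of_mem_fiberPerms h
      (Set.mem_of_indicator_ne_zero (left_ne_zero_of_mul hne))
      (Set.mem_of_indicator_ne_zero (right_ne_zero_of_mul hne)))
  · rw [← Equiv.Perm.viaEmbeddingHom_apply ρ f, ← map_inv, ← map_mul]
    simp only [Equiv.Perm.viaEmbeddingHom_apply, Set.indicator_apply, SetLike.mem_coe,
      viaEmbedding_mem_fiberPerms, signChar_apply, sign_viaEmbedding, MonoidHom.one_apply]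

theorem sum_embedding_coeff_youngElement [IsDomain k] [CharZero k] [DecidableEq β] {r : β → γ}
    {c : β → δ} (h : Function.Injective fun x => (r x, c x)) (ρ : Equiv.Perm α) :
    ∑ f : α ↪ β, (youngElement k r c).coeff (ρ.viaEmbedding f) =
      ∑ f : α → β, (youngElement k (r ∘ f) (c ∘ f)).coeff ρ := by
  refine Fintype.sum_of_injective _ DFunLike.coe_injective _ _ (fun f hf => ?_) fun f =>
    coeff_youngElement_viaEmbedding h ρ f
  rw [youngElement_eq_zero, MonoidAlgebra.coeff_zero, Finsupp.zero_apply]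
  exact fun hinj => hf ⟨⟨f, fun x y hxy => hinj (by simp only [Function.comp_apply, hxy])⟩, rfl⟩

/-- The number of fillings `f` of `α` by elements of `β` such that the columns `c (f i)` are
constant on the cycles of `σ` and the rows `r (f i)` are constant on the cycles of `τ`. -/
noncomputable def fillingCount (r : β → γ) (c : β → δ) (σ τ : Equiv.Perm α) : ℕ :=
  Nat.card {f : α → β // σ ∈ fiberPerms (c ∘ f) ∧ τ ∈ fiberPerms (r ∘ f)}

theorem sum_coeff_youngElement (r : β → γ) (c : β → δ) (ρ : Equiv.Perm α) :
    ∑ f : α → β, (youngElement k (r ∘ f) (c ∘ f)).coeff ρ =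
      ∑ σ, signChar k α σ * fillingCount r c σ (σ⁻¹ * ρ) := by
  classical
  simp only [youngElement, coeff_subgroupSum_mul_subgroupSum]
  rw [Finset.sum_comm]
  refine Finset.sum_congr rfl fun σ _ => ?_
  rw [fillingCount, Nat.card_eq_fintype_card, Fintype.card_subtype, Finset.card_filter,
    Nat.cast_sum, Finset.mul_sum]
  refine Finset.sum_congr rfl fun f _ => ?_
  simp only [Set.indicator_apply, SetLike.mem_coe, MonoidHom.one_apply, ite_and]
  split_ifs <;> simp

end YoungElement

section Boxes

/-- The row of a box. -/
def boxRow (lam : YoungDiagram) (x : lam.cells) : ℕ := x.1.1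

/-- The column of a box. -/
def boxCol (lam : YoungDiagram) (x : lam.cells) : ℕ := x.1.2

variable {lam : YoungDiagram}

theorem boxRow_boxCol_injective : Function.Injective fun x => (boxRow lam x, boxCol lam x) :=
  Subtype.val_injective

theorem boxCol_lt_rowLen (x : lam.cells) : boxCol lam x < lam.rowLen (boxRow lam x) :=
  YoungDiagram.mem_iff_lt_rowLen.1 ((YoungDiagram.mem_cells _).1 x.2)

theorem card_boxRow_eq_boxCol_lt (i k : ℕ) :
    (Finset.univ.filter fun x => boxRow lam x = i ∧ boxCol lam x < k).card =
      min (lam.rowLen i) k := by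
  rw [← Finset.card_range (min (lam.rowLen i) k)]
  refine Finset.card_bij (fun x _ => boxCol lam x) (fun x hx => ?_) (fun x hx y hy h => ?_)
    fun j hj => ?_
  · obtain ⟨rfl, hk⟩ := (Finset.mem_filter.1 hx).2
    exact Finset.mem_range.2 (lt_min (boxCol_lt_rowLen x) hk)
  · exact boxRow_boxCol_injective
      (Prod.ext ((Finset.mem_filter.1 hx).2.1.trans (Finset.mem_filter.1 hy).2.1.symm) h)
  · obtain ⟨hj, hk⟩ := lt_min_iff.1 (Finset.mem_range.1 hj)
    exact ⟨⟨(i, j), (YoungDiagram.mem_cells _).2 (YoungDiagram.mem_iff_lt_rowLen.2 hj)⟩,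
      Finset.mem_filter.2 ⟨Finset.mem_univ _, rfl, hk⟩, rfl⟩

theorem card_boxRow_eq (i : ℕ) :
    (Finset.univ.filter fun x => boxRow lam x = i).card = lam.rowLen i := by
  rw [← min_self (lam.rowLen i), ← card_boxRow_eq_boxCol_lt]
  refine congrArg Finset.card (Finset.filter_congr fun x _ => ?_)
  rw [iff_self_and]
  rintro rfl
  exact boxCol_lt_rowLen x

theorem card_fiber_eq_of_card_fiber_le {ι κ : Type*} [DecidableEq κ] {s t : Finset ι} {r : ι → κ}
    (hle : ∀ i, (s.filter fun x => r x = i).card ≤ (t.filter fun x => r x = i).card)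
    (hcard : t.card ≤ s.card) (i : κ) :
    (s.filter fun x => r x = i).card = (t.filter fun x => r x = i).card := by
  by_contra hne
  have hlt := (hle i).lt_of_ne hne
  obtain ⟨x, hx⟩ := Finset.card_pos.1 (Nat.zero_lt_of_lt hlt)
  obtain ⟨hxt, hxi⟩ := Finset.mem_filter.1 hx
  have hs : (↑s : Set ι).MapsTo r ↑(s.image r ∪ t.image r) := fun y hy =>
    Finset.mem_union_left _ (Finset.mem_image_of_mem r hy)
  have ht : (↑t : Set ι).MapsTo r ↑(s.image r ∪ t.image r) := fun y hy =>
    Finset.mem_union_right _ (Finset.mem_image_of_mem r hy)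
  refine hcard.not_gt ?_
  rw [Finset.card_eq_sum_card_fiberwise hs, Finset.card_eq_sum_card_fiberwise ht]
  exact Finset.sum_lt_sum (fun j _ => hle j) ⟨i, hxi ▸ ht hxt, hlt⟩

/-- The proof compares, row by row, the boxes which `g` moves to one of the first `k` columns with
the boxes of these columns. -/
theorem boxCol_apply_lt_rowLen {g : BoxPerm lam}
    (hg : Function.Injective fun x => (boxRow lam x, boxCol lam (g x))) (x : lam.cells) :
    boxCol lam (g x) < lam.rowLen (boxRow lam x) := by
  set k := lam.rowLen (boxRow lam x)
  set s := Finset.univ.filter fun y => boxCol lam (g y) < k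
  set t := Finset.univ.filter fun y => boxCol lam y < k
  have ht : ∀ i, (t.filter fun y => boxRow lam y = i).card = min (lam.rowLen i) k := fun i => by
    simp only [t, Finset.filter_filter, and_comm, ← card_boxRow_eq_boxCol_lt]
  have hle : ∀ i, (s.filter fun y => boxRow lam y = i).card ≤
      (t.filter fun y => boxRow lam y = i).card := by
    intro i
    rw [ht, le_min_iff]
    constructor
    · rw [← card_boxRow_eq]
      exact Finset.card_le_card (Finset.filter_subset_filter _ (Finset.subset_univ s))
    · rw [← Finset.card_range k]
      refine Finset.card_le_card_of_injOn (fun y => boxCol lam (g y)) (fun y hy => ?_) ?_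
      · exact Finset.mem_coe.2 (Finset.mem_range.2
          (Finset.mem_filter.1 (Finset.mem_filter.1 hy).1).2)
      · exact fun y hy z hz h => hg (Prod.ext
          ((Finset.mem_filter.1 hy).2.trans (Finset.mem_filter.1 hz).2.symm) h)
  have hcard : t.card ≤ s.card := (Finset.card_equiv g fun y => by simp [s, t]).ge
  have heq := card_fiber_eq_of_card_fiber_le hle hcard (boxRow lam x)
  rw [ht, min_self, ← card_boxRow_eq, Finset.filter_comm, Finset.card_filter_eq_iff] at heq
  exact heq x (Finset.mem_filter.2 ⟨Finset.mem_univ x, rfl⟩)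

theorem exists_mem_fiberPerms_mul_eq {g : BoxPerm lam}
    (hg : Function.Injective fun x => (boxRow lam x, boxCol lam (g x))) :
    ∃ σ ∈ fiberPerms (boxCol lam), ∃ τ ∈ fiberPerms (boxRow lam), g = σ * τ := by
  let f : lam.cells → lam.cells := fun x => ⟨(boxRow lam x, boxCol lam (g x)),
    (YoungDiagram.mem_cells _).2 (YoungDiagram.mem_iff_lt_rowLen.2 (boxCol_apply_lt_rowLen hg x))⟩
  have hf : Function.Injective f := fun x y h => hg (congrArg Subtype.val h)
  let τ : BoxPerm lam := Equiv.ofBijective f (Finite.injective_iff_bijective.1 hf)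
  refine ⟨g * τ⁻¹, fun x => ?_, τ, fun x => rfl, (inv_mul_cancel_right g τ).symm⟩
  obtain ⟨y, rfl⟩ := τ.surjective x
  rw [← Equiv.Perm.mul_apply, inv_mul_cancel_right]
  rfl

variable (lam) in
theorem exists_youngElement_mul_self (k : Type*) [CommRing k] [IsDomain k] [CharZero k] :
    ∃ a : k, youngElement k (boxRow lam) (boxCol lam) * youngElement k (boxRow lam) (boxCol lam) =
      a • youngElement k (boxRow lam) (boxCol lam) := by
  refine exists_subgroupSum_mul_subgroupSum_mul_self fun g => ?_
  by_cases hg : Function.Injective fun x => (boxRow lam x, boxCol lam (g x))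
  · exact Or.inl (exists_mem_fiberPerms_mul_eq hg)
  · obtain ⟨x, y, hxy, hne⟩ := Function.not_injective_iff.1 hg
    obtain ⟨hrow, hcol⟩ := Prod.mk.inj hxy
    refine Or.inr ⟨_, swap_mem_fiberPerms hcol, _, swap_mem_fiberPerms hrow,
      (Equiv.mul_swap_eq_swap_mul g x y).symm, ?_⟩
    rw [signChar_swap (g.injective.ne hne), MonoidHom.one_apply]
    norm_num

end Boxes

section Trace

variable {k A G X M : Type*}

theorem mul_trace_toModuleEnd_span_singleton [Field k] [Ring A] [Algebra k A]
    [FiniteDimensional k A] {c : A} {a : k} (hc : c * c = a • c) (x : A) :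
    a * LinearMap.trace k (Submodule.span A {c})
        (Algebra.lsmul k k (Submodule.span A {c}) x) =
      LinearMap.trace k A ((LinearMap.mulRight k c).comp (LinearMap.mulLeft k x)) := by
  let p : Submodule k A := (Submodule.span A {c}).restrictScalars k
  have hp : ∀ y, (LinearMap.mulRight k c).comp (LinearMap.mulLeft k x) y ∈ p := fun y =>
    Submodule.mem_span_singleton.2 ⟨_, rfl⟩
  rw [← LinearMap.trace_restrict_eq_of_forall_mem p _ hp, ← smul_eq_mul, ← map_smul]
  change LinearMap.trace k p _ = LinearMap.trace k p _
  refine congrArg _ (LinearMap.ext fun y => Subtype.ext ?_)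
  obtain ⟨y, hy⟩ := y
  obtain ⟨z, rfl⟩ := Submodule.mem_span_singleton.1 hy
  change a • (x * (z * c)) = x * (z * c) * c
  rw [mul_assoc, mul_assoc z, hc, mul_smul_comm, mul_smul_comm]

theorem trace_mulRight_comp_mulLeft_single [CommRing k] [Group G] [Fintype G] (g : G)
    (c : MonoidAlgebra k G) :
    LinearMap.trace k (MonoidAlgebra k G)
        ((LinearMap.mulRight k c).comp (LinearMap.mulLeft k (MonoidAlgebra.single g 1))) =
      ∑ h : G, c.coeff (h⁻¹ * g⁻¹ * h) := by
  classical
  rw [LinearMap.trace_eq_matrix_trace k (MonoidAlgebra.basis G k), Matrix.trace]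
  refine Finset.sum_congr rfl fun h _ => ?_
  rw [Matrix.diag_apply, LinearMap.toMatrix_apply, LinearMap.comp_apply, LinearMap.mulLeft_apply,
    LinearMap.mulRight_apply, MonoidAlgebra.basis_apply, MonoidAlgebra.single_mul_single]
  change (MonoidAlgebra.single (g * h) (1 * 1) * c).coeff h = _
  rw [MonoidAlgebra.coeff_single_mul_apply, mul_one, one_mul, _root_.mul_inv_rev]

theorem card_nsmul_sum_smul [Group G] [Fintype G] [Fintype X] [AddCommMonoid M] [MulAction G X]
    [MulAction.IsPretransitive G X] (F : X → M) (x₀ : X) :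
    Fintype.card X • ∑ g : G, F (g • x₀) = Fintype.card G • ∑ x, F x := by
  have hbase : ∀ x, ∑ g : G, F (g • x) = ∑ g : G, F (g • x₀) := by
    intro x
    obtain ⟨h, rfl⟩ := MulAction.exists_smul_eq G x₀ x
    exact Fintype.sum_equiv (Equiv.mulRight h) _ _ fun g => by rw [Equiv.coe_mulRight, mul_smul]
  have htranslate : ∀ g : G, ∑ x, F (g • x) = ∑ x, F x := fun g =>
    Fintype.sum_equiv (MulAction.toPerm g) _ _ fun _ => rfl
  calc Fintype.card X • ∑ g : G, F (g • x₀) = ∑ x, ∑ g : G, F (g • x) := by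
        simp only [hbase, Finset.sum_const, Finset.card_univ]
    _ = ∑ g : G, ∑ x, F (g • x) := Finset.sum_comm
    _ = Fintype.card G • ∑ x, F x := by
        simp only [htranslate, Finset.sum_const, Finset.card_univ]

end Trace

section NormalizedCharacter

variable (lam : YoungDiagram)

theorem columnAntisymmetrizer_mul_rowSymmetrizer :
    columnAntisymmetrizer lam * rowSymmetrizer lam =
      youngElement ℂ (boxRow lam) (boxCol lam) := by
  classical
  rw [youngElement, subgroupSum, subgroupSum, columnAntisymmetrizer, rowSymmetrizer,
    Finset.sum_filter, Finset.sum_filter]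
  congr! 1
  all_goals
    refine Finset.sum_congr rfl fun σ _ => ?_
    rw [Set.indicator_apply, apply_ite (MonoidAlgebra.single σ), MonoidAlgebra.single_zero]
    congr!

variable {lam}

theorem spechtRep_character_div (g : BoxPerm lam) :
    (spechtRep lam).character g / (spechtRep lam).character 1 =
      (∑ h : BoxPerm lam, (youngElement ℂ (boxRow lam) (boxCol lam)).coeff (h⁻¹ * g⁻¹ * h)) /
        lam.card.factorial := by
  obtain ⟨a, ha⟩ := exists_youngElement_mul_self lam ℂ
  have htrace : ∀ g, a * (spechtRep lam).character g =
      ∑ h, (youngElement ℂ (boxRow lam) (boxCol lam)).coeff (h⁻¹ * g⁻¹ * h) := by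
    intro g
    rw [← trace_mulRight_comp_mulLeft_single, ← columnAntisymmetrizer_mul_rowSymmetrizer,
      ← mul_trace_toModuleEnd_span_singleton
        (by rw [columnAntisymmetrizer_mul_rowSymmetrizer, ha])]
    rfl
  have hone : a * (spechtRep lam).character 1 = lam.card.factorial := by
    simp only [htrace, inv_one, mul_one, inv_mul_cancel, youngElement,
      coeff_one_subgroupSum_mul_subgroupSum (disjoint_fiberPerms boxRow_boxCol_injective),
      Finset.sum_const, Finset.card_univ, Fintype.card_perm, Fintype.card_coe, nsmul_one]
  have hne : a * (spechtRep lam).character 1 ≠ 0 := by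
    rw [hone]
    exact_mod_cast lam.card.factorial_ne_zero
  rw [← hone, ← htrace, mul_div_mul_left _ _ (left_ne_zero_of_mul hne)]

theorem normalizedCharacter_eq_sum_embedding {l : ℕ} (π : Equiv.Perm (Fin l)) :
    normalizedCharacter lam π = ∑ f : Fin l ↪ lam.cells,
      (youngElement ℂ (boxRow lam) (boxCol lam)).coeff (π⁻¹.viaEmbedding f) := by
  have hcard : Fintype.card (Fin l ↪ lam.cells) = lam.card.descFactorial l := by
    rw [Fintype.card_embedding_eq, Fintype.card_fin, Fintype.card_coe, YoungDiagram.card]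
  rw [normalizedCharacter]
  split_ifs with h
  · let ι : Fin l ↪ lam.cells := (Fin.castLEEmb h).trans lam.cells.equivFin.symm.toEmbedding
    have hconj : ∀ g : BoxPerm lam,
        g⁻¹ * (toBoxPerm lam h π)⁻¹ * g = π⁻¹.viaEmbedding (g⁻¹ • ι) := by
      intro g
      have hι : toBoxPerm lam h π = Equiv.Perm.viaEmbeddingHom ι π := permCongr_viaEmbedding _ _ _
      rw [hι, ← map_inv, Equiv.Perm.viaEmbeddingHom_apply, ← conj_viaEmbedding, inv_inv]
    have : MulAction.IsPretransitive (BoxPerm lam) (Fin l ↪ lam.cells) :=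
      ⟨Equiv.Perm.exists_smul_eq_embedding⟩
    have hsum := card_nsmul_sum_smul (G := BoxPerm lam) (fun f : Fin l ↪ lam.cells =>
      (youngElement ℂ (boxRow lam) (boxCol lam)).coeff (π⁻¹.viaEmbedding f)) ι
    rw [hcard, Fintype.card_perm, Fintype.card_coe, nsmul_eq_mul, nsmul_eq_mul,
      ← Equiv.sum_comp (Equiv.inv _)] at hsum
    rw [spechtRep_character_div, ← mul_div_assoc, div_eq_iff
      (Nat.cast_ne_zero.2 lam.card.factorial_ne_zero), mul_comm (∑ f, _)]
    simp only [hconj]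
    exact hsum
  · have : IsEmpty (Fin l ↪ lam.cells) := by
      rw [← Fintype.card_eq_zero_iff, hcard, Nat.descFactorial_eq_zero_iff_lt]
      exact not_le.1 h
    rw [Fintype.sum_empty]

/-- The formula of Stanley and Féray. Embeddings may be replaced by arbitrary maps, since the Young
element of a non-injective filling vanishes. -/
theorem normalizedCharacter_eq_sum_fillingCount {l : ℕ} (π : Equiv.Perm (Fin l)) :
    normalizedCharacter lam π =
      ∑ σ, signChar ℂ (Fin l) σ * fillingCount (boxRow lam) (boxCol lam) σ (σ⁻¹ * π⁻¹) := by
  rw [normalizedCharacter_eq_sum_embedding,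
    sum_embedding_coeff_youngElement boxRow_boxCol_injective, sum_coeff_youngElement]

end NormalizedCharacter

section Gaussian

open Real

theorem measurePreserving_withDensity_comp {α β : Type*} [MeasurableSpace α] [MeasurableSpace β]
    {μ : Measure α} {ν : Measure β} {e : α ≃ᵐ β} (he : MeasurePreserving e μ ν)
    (f : β → ENNReal) : MeasurePreserving e (μ.withDensity (f ∘ e)) (ν.withDensity f) := by
  refine ⟨e.measurable, Measure.ext fun s hs => ?_⟩
  rw [MeasurableEquiv.map_apply, withDensity_apply _ (e.measurable hs), withDensity_apply _ hs]
  exact he.setLIntegral_comp_preimage_emb e.measurableEmbedding f s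

theorem gaussianPDF_half_mul_gaussianPDF_half (z : ℂ) :
    gaussianPDF 0 (1 / 2) z.re * gaussianPDF 0 (1 / 2) z.im =
      ENNReal.ofReal (π⁻¹ * rexp (-‖z‖ ^ 2)) := by
  have hvar : 2 * ((1 / 2 : NNReal) : ℝ) = 1 := by norm_num
  rw [gaussianPDF, gaussianPDF, ← ENNReal.ofReal_mul (gaussianPDFReal_nonneg _ _ _)]
  refine congrArg ENNReal.ofReal ?_
  calc gaussianPDFReal 0 (1 / 2) z.re * gaussianPDFReal 0 (1 / 2) z.im
      = (√π * √π)⁻¹ * (rexp (-z.re ^ 2) * rexp (-z.im ^ 2)) := by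
        rw [gaussianPDFReal, gaussianPDFReal, mul_right_comm (2 : ℝ), hvar,
          mul_mul_mul_comm, ← mul_inv]
        simp only [one_mul, sub_zero, div_one]
    _ = π⁻¹ * rexp (-‖z‖ ^ 2) := by
        rw [mul_self_sqrt pi_pos.le, ← exp_add, ← Complex.normSq_eq_norm_sq, Complex.normSq_apply]
        ring_nf

theorem stdComplexGaussian_eq_withDensity : stdComplexGaussian =
    volume.withDensity fun z : ℂ => ENNReal.ofReal (π⁻¹ * rexp (-‖z‖ ^ 2)) := by
  have hvar : (1 / 2 : NNReal) ≠ 0 := by norm_num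
  rw [stdComplexGaussian, gaussianReal_of_var_ne_zero _ hvar,
    prod_withDensity (measurable_gaussianPDF _ _) (measurable_gaussianPDF _ _),
    ← (measurePreserving_withDensity_comp Complex.volume_preserving_equiv_real_prod.symm _).map_eq]
  refine congrArg (Measure.map _) (congrArg _ (funext fun z => ?_))
  exact gaussianPDF_half_mul_gaussianPDF_half ⟨z.1, z.2⟩

instance isProbabilityMeasure_stdComplexGaussian : IsProbabilityMeasure stdComplexGaussian :=
  Measure.isProbabilityMeasure_map Complex.measurableEquivRealProd.symm.measurable.aemeasurable

theorem measurePreserving_rotation_stdComplexGaussian (u : Circle) :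
    MeasurePreserving (rotation u) stdComplexGaussian stdComplexGaussian := by
  have h := measurePreserving_withDensity_comp (e := (rotation u).toHomeomorph.toMeasurableEquiv)
    (rotation u).measurePreserving fun z : ℂ => ENNReal.ofReal (π⁻¹ * rexp (-‖z‖ ^ 2))
  have hnorm : (fun z : ℂ => ENNReal.ofReal (π⁻¹ * rexp (-‖z‖ ^ 2))) ∘ rotation u =
      fun z => ENNReal.ofReal (π⁻¹ * rexp (-‖z‖ ^ 2)) := by
    funext z
    rw [Function.comp_apply, LinearIsometryEquiv.norm_map]
  rw [stdComplexGaussian_eq_withDensity]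
  convert! h using 2
  exact hnorm.symm

theorem integral_stdComplexGaussian {E : Type*} [NormedAddCommGroup E] [NormedSpace ℝ E]
    (f : ℂ → E) :
    ∫ z, f z ∂stdComplexGaussian = ∫ z, (π⁻¹ * rexp (-‖z‖ ^ 2)) • f z := by
  rw [stdComplexGaussian_eq_withDensity, integral_withDensity_eq_integral_toReal_smul (by fun_prop)
    (Filter.Eventually.of_forall fun z => ENNReal.ofReal_lt_top)]
  refine integral_congr_ae (Filter.Eventually.of_forall fun z => ?_)
  dsimp only
  rw [ENNReal.toReal_ofReal (by positivity)]

theorem integral_norm_pow_stdComplexGaussian (n : ℕ) :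
    ∫ z, ‖z‖ ^ n ∂stdComplexGaussian = Gamma (n / 2 + 1) := by
  have h := Complex.integral_rpow_mul_exp_neg_rpow (p := 2) (q := n) one_le_two
    (lt_of_lt_of_le (by norm_num) n.cast_nonneg)
  simp only [rpow_natCast, rpow_two] at h
  simp only [integral_stdComplexGaussian, smul_eq_mul, mul_assoc, integral_const_mul,
    mul_comm (rexp _), h]
  rw [mul_div_cancel_left₀ _ two_ne_zero, inv_mul_cancel_left₀ pi_pos.ne', add_div,
    div_self two_ne_zero]

theorem integrable_pow_mul_conj_pow (a b : ℕ) :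
    Integrable (fun z : ℂ => z ^ a * (starRingEnd ℂ z) ^ b) stdComplexGaussian := by
  have hnorm : Integrable (fun z : ℂ => ‖z‖ ^ (a + b)) stdComplexGaussian := by
    refine Integrable.of_integral_ne_zero ?_
    rw [integral_norm_pow_stdComplexGaussian]
    exact (Gamma_pos_of_pos (by positivity)).ne'
  refine hnorm.mono' (by fun_prop) (Filter.Eventually.of_forall fun z => le_of_eq ?_)
  rw [norm_mul, norm_pow, norm_pow, RCLike.norm_conj, pow_add]

theorem integral_pow_mul_conj_pow_self (a : ℕ) :
    ∫ z, z ^ a * (starRingEnd ℂ z) ^ a ∂stdComplexGaussian = a.factorial := by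
  have hnorm : ∀ z : ℂ, z ^ a * (starRingEnd ℂ z) ^ a = ((‖z‖ ^ (2 * a) : ℝ) : ℂ) := fun z => by
    rw [← mul_pow, Complex.mul_conj, Complex.normSq_eq_norm_sq, ← Complex.ofReal_pow, pow_mul]
  simp only [hnorm]
  rw [integral_complex_ofReal, integral_norm_pow_stdComplexGaussian, Nat.cast_mul, Nat.cast_two,
    mul_div_cancel_left₀ _ two_ne_zero, Gamma_nat_eq_factorial, Complex.ofReal_natCast]

/-- The law of `z` is invariant under rotations, and some rotation changes the sign of
`z ^ a * conj z ^ b`. -/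
theorem integral_pow_mul_conj_pow_of_ne {a b : ℕ} (hab : a ≠ b) :
    ∫ z, z ^ a * (starRingEnd ℂ z) ^ b ∂stdComplexGaussian = 0 := by
  have hd : (a : ℝ) - b ≠ 0 := sub_ne_zero.2 (Nat.cast_injective.ne hab)
  let u : Circle := Circle.exp (π / (a - b))
  have hu : (u : ℂ) ^ a * (starRingEnd ℂ u) ^ b = -1 := by
    have hpow : u ^ a * (u⁻¹) ^ b = Circle.exp π := by
      rw [inv_pow, ← div_eq_mul_inv, ← Circle.exp_natCast_mul, ← Circle.exp_natCast_mul,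
        ← Circle.exp_sub, ← sub_mul, mul_div_cancel₀ _ hd]
    rw [← Circle.coe_inv_eq_conj, ← Circle.coe_pow, ← Circle.coe_pow, ← Circle.coe_mul, hpow,
      Circle.coe_exp, Complex.exp_pi_mul_I]
  have hmul : ∀ z : ℂ, (rotation u z) ^ a * (starRingEnd ℂ (rotation u z)) ^ b =
      -(z ^ a * (starRingEnd ℂ z) ^ b) := fun z => by
    rw [rotation_apply, map_mul, mul_pow, mul_pow, mul_mul_mul_comm, hu, neg_one_mul]
  have h := (measurePreserving_rotation_stdComplexGaussian u).integral_comp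
    (rotation u).toHomeomorph.measurableEmbedding fun z => z ^ a * (starRingEnd ℂ z) ^ b
  simp only [hmul, integral_neg] at h
  exact self_eq_neg.1 h.symm

end Gaussian

section Wick

variable {α ι : Type*}

theorem card_perm_comp_eq_zero {x y : α → ι} {k : ι}
    (h : Nat.card {a // x a = k} ≠ Nat.card {a // y a = k}) :
    Nat.card {σ : Equiv.Perm α // x ∘ σ = y} = 0 := by
  have : IsEmpty {σ : Equiv.Perm α // x ∘ σ = y} := by
    refine ⟨fun σ => h ?_⟩
    obtain ⟨σ, rfl⟩ := σ
    exact (Nat.card_congr (σ.subtypeEquiv fun a => Iff.rfl)).symm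
  exact Nat.card_of_isEmpty

theorem card_perm_comp_eq_prod_factorial [Finite α] [Fintype ι] {x y : α → ι}
    (h : ∀ k, Nat.card {a // x a = k} = Nat.card {a // y a = k}) :
    Nat.card {σ : Equiv.Perm α // x ∘ σ = y} = ∏ k, (Nat.card {a // x a = k}).factorial := by
  classical
  have := Fintype.ofFinite α
  let e : ∀ k, {a // y a = k} ≃ {a // x a = k} := fun k =>
    Fintype.equivOfCardEq (by simpa only [Nat.card_eq_fintype_card] using (h k).symm)
  let σ₀ : Equiv.Perm α := (Equiv.sigmaFiberEquiv y).symm.trans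
    ((Equiv.sigmaCongrRight e).trans (Equiv.sigmaFiberEquiv x))
  have hσ₀ : x ∘ σ₀ = y := funext fun a => (e (y a) ⟨a, rfl⟩).2
  have htranslate : Nat.card {σ : Equiv.Perm α // x ∘ σ = y} =
      Nat.card {σ : Equiv.Perm α // x ∘ σ = x} := by
    refine Nat.card_congr ((Equiv.mulRight σ₀⁻¹).subtypeEquiv fun σ => ?_)
    rw [Equiv.coe_mulRight, Equiv.Perm.coe_mul, ← Function.comp_assoc, ← hσ₀]
    exact (Equiv.comp_symm_eq σ₀ x (x ∘ σ)).symm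
  rw [htranslate, Nat.card_eq_fintype_card, DomMulAct.stabilizer_card]
  simp only [Nat.card_eq_fintype_card]

variable [Fintype α]

theorem prod_comp_eq_prod_pow_card [Fintype ι] {M : Type*} [CommMonoid M] (x : α → ι)
    (t : ι → M) : ∏ a, t (x a) = ∏ k, t k ^ Nat.card {a // x a = k} := by
  classical
  rw [← Finset.prod_fiberwise Finset.univ x]
  refine Finset.prod_congr rfl fun k _ => ?_
  rw [Nat.card_eq_fintype_card, Fintype.card_subtype]
  exact Finset.prod_eq_pow_card fun a ha => by rw [(Finset.mem_filter.1 ha).2]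

variable [Fintype ι] (x y : α → ι)

theorem prod_mul_conj_eq_prod_pow_mul_conj_pow (t : ι → ℂ) :
    ∏ a, t (x a) * starRingEnd ℂ (t (y a)) =
      ∏ k, t k ^ Nat.card {a // x a = k} * starRingEnd ℂ (t k) ^ Nat.card {a // y a = k} := by
  rw [Finset.prod_mul_distrib, Finset.prod_mul_distrib, prod_comp_eq_prod_pow_card x t,
    prod_comp_eq_prod_pow_card y fun k => starRingEnd ℂ (t k)]

theorem integrable_prod_mul_conj :
    Integrable (fun t : ι → ℂ => ∏ a, t (x a) * starRingEnd ℂ (t (y a)))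
      (Measure.pi fun _ => stdComplexGaussian) := by
  simp only [prod_mul_conj_eq_prod_pow_mul_conj_pow]
  exact Integrable.fintype_prod (f := fun k z => z ^ Nat.card {a // x a = k} *
    starRingEnd ℂ z ^ Nat.card {a // y a = k}) fun k => integrable_pow_mul_conj_pow _ _

theorem integral_prod_mul_conj :
    ∫ t : ι → ℂ, ∏ a, t (x a) * starRingEnd ℂ (t (y a))
        ∂(Measure.pi fun _ => stdComplexGaussian) =
      Nat.card {σ : Equiv.Perm α // y ∘ σ = x} := by
  simp only [prod_mul_conj_eq_prod_pow_mul_conj_pow]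
  rw [integral_fintype_prod_eq_prod (f := fun k z => z ^ Nat.card {a // x a = k} *
    starRingEnd ℂ z ^ Nat.card {a // y a = k})]
  by_cases h : ∀ k, Nat.card {a // y a = k} = Nat.card {a // x a = k}
  · rw [card_perm_comp_eq_prod_factorial h, Nat.cast_prod]
    simp only [h, integral_pow_mul_conj_pow_self]
  · obtain ⟨k, hk⟩ := not_forall.1 h
    rw [card_perm_comp_eq_zero hk, Nat.cast_zero, Finset.prod_eq_zero (Finset.mem_univ k)]
    exact integral_pow_mul_conj_pow_of_ne (Ne.symm hk)

end Wick

section TraceSum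

theorem sameCycle_permCongr {α β : Type*} (e : α ≃ β) {π : Equiv.Perm α} {x y : α}
    (h : π.SameCycle x y) : (e.permCongr π).SameCycle (e x) (e y) := by
  obtain ⟨k, rfl⟩ := h
  refine ⟨k, ?_⟩
  have hpow : (e.permCongr π) ^ k = e.permCongr (π ^ k) := (map_zpow e.permCongrHom π k).symm
  rw [hpow, Equiv.permCongr_apply, Equiv.symm_apply_apply]

variable {R ι : Type*} [CommSemiring R] [Fintype ι] (A : Matrix ι ι R)

theorem sum_prod_cons_snoc [DecidableEq ι] (n : ℕ) (x y : ι) :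
    ∑ a : Fin n → ι, ∏ i : Fin (n + 1),
      A (Fin.cons (α := fun _ => ι) x a i) (Fin.snoc (α := fun _ => ι) a y i) =
      (A ^ (n + 1)) x y := by
  induction n generalizing x with
  | zero => simp [Fin.snoc]
  | succ n ih =>
    rw [← (Fin.consEquiv fun _ => ι).sum_comp, Fintype.sum_prod_type, pow_succ', Matrix.mul_apply]
    refine Finset.sum_congr rfl fun z _ => ?_
    rw [← ih z, Finset.mul_sum]
    refine Finset.sum_congr rfl fun b _ => ?_
    change ∏ i : Fin (n + 2), A (Fin.cons (α := fun _ => ι) x (Fin.cons z b) i)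
      (Fin.snoc (α := fun _ => ι) (Fin.cons z b) y i) = _
    simp only [Fin.prod_univ_succ (n := n + 1), ← Fin.cons_snoc_eq_snoc_cons, Fin.cons_zero,
      Fin.cons_succ]

theorem sum_prod_finRotate [DecidableEq ι] (n : ℕ) :
    ∑ a : Fin (n + 1) → ι, ∏ i, A (a i) (a (finRotate (n + 1) i)) = (A ^ (n + 1)).trace := by
  rw [← (Fin.consEquiv fun _ => ι).sum_comp, Fintype.sum_prod_type, Matrix.trace]
  refine Finset.sum_congr rfl fun x _ => ?_
  rw [Matrix.diag_apply, ← sum_prod_cons_snoc]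
  refine Finset.sum_congr rfl fun b _ => ?_
  rw [Fin.snoc_eq_cons_rotate]
  rfl

variable {α β : Type*} [Fintype α] [DecidableEq α]

theorem sum_prod_permCongr [Fintype β] [DecidableEq β] (e : α ≃ β)
    (π : Equiv.Perm α) :
    ∑ a : β → ι, ∏ i, A (a i) (a (e.permCongr π i)) = ∑ a : α → ι, ∏ i, A (a i) (a (π i)) := by
  rw [← (e.arrowCongr (Equiv.refl ι)).sum_comp]
  refine Finset.sum_congr rfl fun a _ => ?_
  rw [← e.prod_comp]
  simp only [Equiv.arrowCongr_apply, Equiv.coe_refl, Function.comp_apply, id_eq,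
    Equiv.permCongr_apply, Equiv.symm_apply_apply]

section SubtypeCongr

variable {p : α → Prop} [DecidablePred p] (σ : Equiv.Perm {x // p x})
  (τ : Equiv.Perm {x // ¬ p x})

theorem sum_prod_subtypeCongr :
    ∑ a : α → ι, ∏ i, A (a i) (a (σ.subtypeCongr τ i)) =
      (∑ a : {x // p x} → ι, ∏ i, A (a i) (a (σ i))) *
      ∑ a : {x // ¬ p x} → ι, ∏ i, A (a i) (a (τ i)) := by
  rw [Fintype.sum_mul_sum, ← Fintype.sum_prod_type',
    ← (Equiv.piEquivPiSubtypeProd p fun _ => ι).sum_comp]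
  refine Finset.sum_congr rfl fun a _ => ?_
  rw [← Fintype.prod_subtype_mul_prod_subtype p]
  simp only [Equiv.piEquivPiSubtypeProd_apply, Equiv.Perm.subtypeCongr.left_apply_subtype,
    Equiv.Perm.subtypeCongr.right_apply_subtype]

theorem cycleType_subtypeCongr : (σ.subtypeCongr τ).cycleType = σ.cycleType + τ.cycleType := by
  have hmul : σ.subtypeCongr τ = Equiv.Perm.ofSubtype σ * Equiv.Perm.ofSubtype τ := by
    ext x
    by_cases hx : p x
    · rw [Equiv.Perm.mul_apply, Equiv.Perm.ofSubtype_apply_of_not_mem τ (not_not.2 hx),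
        Equiv.Perm.ofSubtype_apply_of_mem σ hx, Equiv.Perm.subtypeCongr.left_apply _ _ hx]
    · rw [Equiv.Perm.mul_apply, Equiv.Perm.ofSubtype_apply_of_mem τ hx,
        Equiv.Perm.ofSubtype_apply_of_not_mem _ (τ ⟨x, hx⟩).2,
        Equiv.Perm.subtypeCongr.right_apply _ _ hx]
  have hdisj : (Equiv.Perm.ofSubtype σ).Disjoint (Equiv.Perm.ofSubtype τ) := fun x => by
    by_cases hx : p x
    · exact Or.inr (Equiv.Perm.ofSubtype_apply_of_not_mem τ (not_not.2 hx))
    · exact Or.inl (Equiv.Perm.ofSubtype_apply_of_not_mem σ hx)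
  rw [hmul, hdisj.cycleType_mul, Equiv.Perm.cycleType_ofSubtype, Equiv.Perm.cycleType_ofSubtype]

theorem parts_partition_subtypeCongr :
    (σ.subtypeCongr τ).partition.parts = σ.partition.parts + τ.partition.parts := by
  have hfixed : Fintype.card α - (σ.subtypeCongr τ).cycleType.sum =
      (Fintype.card {x // p x} - σ.cycleType.sum) +
        (Fintype.card {x // ¬ p x} - τ.cycleType.sum) := by
    rw [cycleType_subtypeCongr, Multiset.sum_add, ← Fintype.card_congr (Equiv.sumCompl p),
      Fintype.card_sum]
    exact (tsub_add_tsub_comm σ.sum_cycleType_le τ.sum_cycleType_le).symm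
  simp only [Equiv.Perm.parts_partition, ← Equiv.Perm.sum_cycleType]
  rw [hfixed, cycleType_subtypeCongr, Multiset.replicate_add, add_add_add_comm]

end SubtypeCongr

theorem parts_partition_of_sameCycle [Nonempty α] {π : Equiv.Perm α}
    (h : ∀ x y, π.SameCycle x y) : π.partition.parts = {Fintype.card α} := by
  rw [Equiv.Perm.parts_partition]
  rcases subsingleton_or_nontrivial α with hα | hα
  · have hcard : Fintype.card α = 1 :=
      le_antisymm (Fintype.card_le_one_iff_subsingleton.2 hα) Fintype.card_pos
    rw [Subsingleton.elim π 1, hcard]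
    simp
  · have hne : ∀ x, π x ≠ x := fun x hx =>
      (exists_ne x).elim fun y hy => hy ((h x y).eq_of_left hx).symm
    have hcycle : π.IsCycle := ⟨Classical.arbitrary α, hne _, fun y _ => h _ y⟩
    have hsupport : π.support = Finset.univ :=
      Finset.eq_univ_of_forall fun x => Equiv.Perm.mem_support.2 (hne x)
    rw [hcycle.cycleType, hsupport, Finset.card_univ, tsub_self, Multiset.replicate_zero, add_zero]

theorem sameCycle_finRotate {n : ℕ} (x y : Fin n) : (finRotate n).SameCycle x y := by
  rcases n with _ | _ | n
  · exact x.elim0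
  · rw [Fin.fin_one_eq_zero x, Fin.fin_one_eq_zero y]
  · have hne : ∀ x, finRotate (n + 2) x ≠ x := fun x => by
      rw [← Equiv.Perm.mem_support, support_finRotate]
      exact Finset.mem_univ x
    exact isCycle_finRotate.sameCycle (hne x) (hne y)

theorem sum_prod_of_sameCycle [DecidableEq ι] [Nonempty α] {π : Equiv.Perm α}
    (h : ∀ x y, π.SameCycle x y) :
    ∑ a : α → ι, ∏ i, A (a i) (a (π i)) = (A ^ Fintype.card α).trace := by
  obtain ⟨n, hn⟩ := Nat.exists_eq_succ_of_ne_zero (Fintype.card_ne_zero (α := α))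
  let e : α ≃ Fin (n + 1) := Fintype.equivFinOfCardEq hn
  have he : ∀ x y, (e.permCongr π).SameCycle x y := fun x y => by
    simpa only [Equiv.apply_symm_apply] using sameCycle_permCongr e (h (e.symm x) (e.symm y))
  have hconj : IsConj (e.permCongr π) (finRotate (n + 1)) := by
    rw [Equiv.Perm.partition_eq_of_isConj, Nat.Partition.ext_iff, parts_partition_of_sameCycle he,
      parts_partition_of_sameCycle sameCycle_finRotate]
  obtain ⟨c, hc⟩ := isConj_iff.1 hconj
  rw [hn, Nat.succ_eq_add_one, ← sum_prod_finRotate, ← hc, ← Equiv.permCongr_eq_mul,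
    sum_prod_permCongr, sum_prod_permCongr]

theorem sum_prod_eq_prod_trace_pow [DecidableEq ι] (π : Equiv.Perm α) :
    ∑ a : α → ι, ∏ i, A (a i) (a (π i)) =
      (π.partition.parts.map fun k => (A ^ k).trace).prod := by
  obtain ⟨n, h⟩ : ∃ n, Fintype.card α = n := ⟨_, rfl⟩
  induction n using Nat.strong_induction_on generalizing α with
  | _ n ih =>
    rcases isEmpty_or_nonempty α with hα | ⟨⟨x⟩⟩
    · simp [Subsingleton.elim π 1, Equiv.Perm.parts_partition]
    · have hp : ∀ y, π.SameCycle x (π y) ↔ π.SameCycle x y := fun y =>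
        Equiv.Perm.sameCycle_apply_right
      let σ := π.subtypePerm hp
      let τ := π.subtypePerm (p := fun y => ¬ π.SameCycle x y) fun y => not_congr (hp y)
      have hπ : π = σ.subtypeCongr τ := by
        ext y
        by_cases hy : π.SameCycle x y
        · rw [Equiv.Perm.subtypeCongr.left_apply _ _ hy, Equiv.Perm.subtypePerm_apply]
        · rw [Equiv.Perm.subtypeCongr.right_apply _ _ hy, Equiv.Perm.subtypePerm_apply]
      have : Nonempty {y // π.SameCycle x y} := ⟨⟨x, Equiv.Perm.SameCycle.refl _ _⟩⟩
      have hσ : ∀ y z, σ.SameCycle y z := fun y z =>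
        Equiv.Perm.sameCycle_subtypePerm.2 (y.2.symm.trans z.2)
      have hτ := ih (Fintype.card {y // ¬ π.SameCycle x y})
        (h ▸ Fintype.card_subtype_lt (x := x) (not_not.2 (Equiv.Perm.SameCycle.refl _ _))) τ rfl
      rw [hπ, sum_prod_subtypeCongr, parts_partition_subtypeCongr, Multiset.map_add,
        Multiset.prod_add, hτ, sum_prod_of_sameCycle A hσ, parts_partition_of_sameCycle hσ,
        Multiset.map_singleton, Multiset.prod_singleton]

end TraceSum

section Expectation

variable {lam : YoungDiagram}

theorem bandMatrix_apply_eq_sum (t : lam.cells → ℂ) (i j : Fin (diagramSize lam)) :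
    bandMatrix lam t i j =
      ∑ x, if boxCol lam x = i ∧ boxRow lam x = j then t x else 0 := by
  rw [bandMatrix, Matrix.of_apply]
  split_ifs with h
  · rw [Finset.sum_eq_single ⟨((j : ℕ), (i : ℕ)), h⟩, if_pos ⟨rfl, rfl⟩]
    · exact fun x _ hx => if_neg fun hx' => hx (Subtype.ext (Prod.ext hx'.2 hx'.1))
    · exact fun hx => absurd (Finset.mem_univ _) hx
  · refine (Finset.sum_eq_zero fun x _ => if_neg ?_).symm
    rintro ⟨hi, hj⟩
    exact h (hi ▸ hj ▸ x.2)

theorem boxCol_lt_diagramSize (x : lam.cells) : boxCol lam x < diagramSize lam :=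
  lt_max_of_lt_left (YoungDiagram.mem_iff_lt_rowLen.1
    (lam.up_left_mem (Nat.zero_le _) le_rfl ((YoungDiagram.mem_cells x.1).1 x.2)))

theorem boxRow_lt_diagramSize (x : lam.cells) : boxRow lam x < diagramSize lam :=
  lt_max_of_lt_right (YoungDiagram.mem_iff_lt_colLen.1
    (lam.up_left_mem le_rfl (Nat.zero_le _) ((YoungDiagram.mem_cells x.1).1 x.2)))

theorem bandMatrix_mul_conjTranspose_apply (t : lam.cells → ℂ) (i i' : Fin (diagramSize lam)) :
    (bandMatrix lam t * (bandMatrix lam t)ᴴ) i i' = ∑ z : lam.cells × lam.cells,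
      if boxCol lam z.1 = i ∧ boxCol lam z.2 = i' ∧ boxRow lam z.2 = boxRow lam z.1 then
        t z.1 * starRingEnd ℂ (t z.2) else 0 := by
  simp only [Matrix.mul_apply, Matrix.conjTranspose_apply, bandMatrix_apply_eq_sum, star_sum,
    Finset.sum_mul_sum, ← Finset.univ_product_univ, Finset.sum_product]
  rw [Finset.sum_comm]
  refine Finset.sum_congr rfl fun x _ => ?_
  rw [Finset.sum_comm]
  refine Finset.sum_congr rfl fun y _ => ?_
  rw [Finset.sum_eq_single ⟨boxRow lam x, boxRow_lt_diagramSize x⟩]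
  · simp only [and_true, apply_ite star, star_zero, ite_and]
    aesop
  · intro j _ hj
    rw [if_neg fun h => hj (Fin.ext h.2.symm), zero_mul]
  · exact fun h => absurd (Finset.mem_univ _) h

theorem traceProduct_eq_sum {l : ℕ} (π : Equiv.Perm (Fin l)) (t : lam.cells → ℂ) :
    traceProduct lam π t = ∑ z : (Fin l → lam.cells) × (Fin l → lam.cells),
      if boxCol lam ∘ z.2 = boxCol lam ∘ z.1 ∘ π ∧ boxRow lam ∘ z.2 = boxRow lam ∘ z.1 then
        ∏ i, t (z.1 i) * starRingEnd ℂ (t (z.2 i)) else 0 := by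
  let col : lam.cells → Fin (diagramSize lam) := fun x => ⟨boxCol lam x, boxCol_lt_diagramSize x⟩
  rw [traceProduct, ← sum_prod_eq_prod_trace_pow]
  simp only [bandMatrix_mul_conjTranspose_apply, Finset.prod_univ_sum, Fintype.piFinset_univ,
    Finset.prod_ite_zero]
  rw [Finset.sum_comm, ← (Equiv.arrowProdEquivProdArrow _ _ _).sum_comp]
  refine Finset.sum_congr rfl fun z _ => ?_
  rw [Finset.sum_eq_single fun i => col (z i).1]
  · simp [col, funext_iff, forall_and, Equiv.arrowProdEquivProdArrow]
  · intro a _ ha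
    exact if_neg fun h => ha (funext fun i => Fin.ext (h i (Finset.mem_univ i)).1.symm)
  · exact fun h => absurd (Finset.mem_univ _) h

theorem integrable_traceProduct {l : ℕ} (π : Equiv.Perm (Fin l)) :
    Integrable (traceProduct lam π) (entryLaw lam) := by
  simp only [funext (traceProduct_eq_sum π)]
  refine integrable_finsetSum _ fun z _ => ?_
  split_ifs
  · exact integrable_prod_mul_conj z.1 z.2
  · exact integrable_zero _ _ _

theorem fillingCount_inv {α β γ δ : Type*} (r : β → γ) (c : β → δ) (σ τ : Equiv.Perm α) :
    fillingCount r c σ⁻¹ τ = fillingCount r c σ τ := by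
  simp only [fillingCount, inv_mem_iff]

theorem card_pair_eq_fillingCount {α β γ δ : Type*} (r : β → γ) (c : β → δ)
    (π τ : Equiv.Perm α) :
    Nat.card {z : (α → β) × (α → β) //
      (c ∘ z.2 = c ∘ z.1 ∘ π ∧ r ∘ z.2 = r ∘ z.1) ∧ z.2 ∘ τ = z.1} =
      fillingCount r c (τ * π) τ := by
  refine Nat.card_congr ⟨fun z => ⟨z.1.2, ?_⟩, fun g => ⟨(g.1 ∘ τ, g.1), ?_⟩, ?_, fun g => rfl⟩
  · obtain ⟨⟨f, g⟩, ⟨hc, hr⟩, hf : g ∘ τ = f⟩ := z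
    subst hf
    exact ⟨fun x => (congrFun hc x).symm, fun x => (congrFun hr x).symm⟩
  · exact ⟨⟨funext fun x => (g.2.1 x).symm, funext fun x => (g.2.2 x).symm⟩, rfl⟩
  · exact fun z => Subtype.ext (Prod.ext z.2.2 rfl)

theorem integral_traceProduct {l : ℕ} (π : Equiv.Perm (Fin l)) :
    ∫ t, traceProduct lam π t ∂(entryLaw lam) = ∑ σ : Equiv.Perm (Fin l),
      (fillingCount (boxRow lam) (boxCol lam) σ (σ⁻¹ * π⁻¹) : ℂ) := by
  let P : (Fin l → lam.cells) × (Fin l → lam.cells) → Prop := fun z =>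
    boxCol lam ∘ z.2 = boxCol lam ∘ z.1 ∘ π ∧ boxRow lam ∘ z.2 = boxRow lam ∘ z.1
  calc ∫ t, traceProduct lam π t ∂(entryLaw lam)
      = ∑ z, if P z then (Nat.card {τ : Equiv.Perm (Fin l) // z.2 ∘ τ = z.1} : ℂ) else 0 := by
        simp only [traceProduct_eq_sum]
        rw [integral_finsetSum]
        · refine Finset.sum_congr rfl fun z _ => ?_
          split_ifs with h
          · exact integral_prod_mul_conj z.1 z.2
          · exact integral_zero _ _
        · intro z _
          split_ifs
          · exact integrable_prod_mul_conj z.1 z.2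
          · exact integrable_zero _ _ _
    _ = ∑ τ : Equiv.Perm (Fin l), (Nat.card {z // P z ∧ z.2 ∘ τ = z.1} : ℂ) := by
        simp only [Nat.card_eq_fintype_card, Fintype.card_subtype, Finset.card_filter,
          Nat.cast_sum, ite_and, Nat.cast_ite, Nat.cast_one, Nat.cast_zero]
        rw [Finset.sum_comm]
        refine Finset.sum_congr rfl fun z _ => ?_
        split_ifs <;> simp
    _ = ∑ τ : Equiv.Perm (Fin l), (fillingCount (boxRow lam) (boxCol lam) (τ * π)⁻¹ τ : ℂ) := by
        simp only [P, card_pair_eq_fillingCount, fillingCount_inv]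
    _ = _ := Fintype.sum_equiv ((Equiv.mulRight π).trans (Equiv.inv _)) _ _ fun τ => by
        simp only [Equiv.trans_apply, Equiv.coe_mulRight, Equiv.inv_apply, inv_inv,
          mul_inv_cancel_right]

end Expectation

section Cycles

/-- The cycles of a permutation. Fixed points count as cycles, in contrast to
`Equiv.Perm.cycleType`. -/
abbrev PermCycles {α : Type*} (σ : Equiv.Perm α) : Type _ :=
  Quotient (Equiv.Perm.SameCycle.setoid σ)

namespace PermCycles

noncomputable instance {α : Type*} [Finite α] (σ : Equiv.Perm α) : Fintype (PermCycles σ) :=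
  Fintype.ofFinite _

noncomputable instance {α : Type*} (σ : Equiv.Perm α) : DecidableEq (PermCycles σ) :=
  Classical.decEq _

variable {α X : Type*} {σ : Equiv.Perm α}

theorem apply_eq_of_sameCycle {f : α → X} (hf : σ ∈ fiberPerms f) {i j : α}
    (h : σ.SameCycle i j) : f i = f j := by
  obtain ⟨n, rfl⟩ := h
  exact ((fiberPerms f).zpow_mem hf n i).symm

/-- The functions on the cycles of `σ` as the functions which are constant along `σ`. -/
def arrowEquiv (σ : Equiv.Perm α) (X : Type*) :
    (PermCycles σ → X) ≃ {f : α → X // σ ∈ fiberPerms f} where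
  toFun g := ⟨fun i => g (Quotient.mk _ i), fun i => congrArg g (Quotient.sound
    (Equiv.Perm.sameCycle_apply_left.2 (Equiv.Perm.SameCycle.refl σ i)))⟩
  invFun f := Quotient.lift f.1 fun _ _ => apply_eq_of_sameCycle f.2
  left_inv _ := funext fun i => i.inductionOn fun _ => rfl
  right_inv _ := rfl

theorem card_eq_card_parts_partition [Fintype α] [DecidableEq α] (σ : Equiv.Perm α) :
    Fintype.card (PermCycles σ) = Multiset.card σ.partition.parts := by
  classical
  -- Both sides are read off the trace formula for the identity matrix of size `2`.
  have hone : ∀ a : α → Fin 2, ∏ i, (1 : Matrix (Fin 2) (Fin 2) ℕ) (a i) (a (σ i)) =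
      if σ ∈ fiberPerms a then 1 else 0 := fun a => by
    simp only [Matrix.one_apply, Finset.prod_boole, Finset.mem_univ, true_imp_iff, mem_fiberPerms,
      eq_comm]
  have htrace := sum_prod_eq_prod_trace_pow (1 : Matrix (Fin 2) (Fin 2) ℕ) σ
  simp only [hone, Finset.sum_boole, ← Fintype.card_subtype, one_pow, Matrix.trace_one,
    ← Fintype.card_congr (arrowEquiv σ (Fin 2)), Multiset.map_const', Multiset.prod_replicate,
    Fintype.card_fun, Fintype.card_fin, Nat.cast_id] at htrace
  exact Nat.pow_right_injective le_rfl htrace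

theorem sign_eq_neg_one_pow [Fintype α] [DecidableEq α] (σ : Equiv.Perm α) :
    Equiv.Perm.sign σ = (-1) ^ (Fintype.card α + Fintype.card (PermCycles σ)) := by
  obtain ⟨k, hk⟩ := Nat.exists_eq_add_of_le σ.sum_cycleType_le
  rw [card_eq_card_parts_partition, Equiv.Perm.parts_partition, Multiset.card_add,
    Multiset.card_replicate, ← Equiv.Perm.sum_cycleType, hk, Nat.add_sub_cancel_left,
    Equiv.Perm.sign_of_cycleType, add_add_add_comm, ← two_mul k, pow_add _ _ (2 * k),
    pow_mul, neg_one_sq, one_pow, mul_one]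

end PermCycles

end Cycles

section Multirect

section CycleMax

variable {α X : Type*} [Fintype α] [LinearOrder X] (σ : Equiv.Perm α) (g : α → X)

open Classical in
/-- The largest value of `g` on a cycle of `σ`. Since long rows of a diagram come first, it selects
the shortest of the rows chosen along the cycle. -/
noncomputable def cycleMax (d : PermCycles σ) : X :=
  Finset.sup' {i | Quotient.mk _ i = d}
    (d.inductionOn fun i => ⟨i, Finset.mem_filter.2 ⟨Finset.mem_univ i, rfl⟩⟩) g

variable {σ}

theorem apply_le_cycleMax (i : α) : g i ≤ cycleMax σ g (Quotient.mk _ i) := by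
  rw [cycleMax]
  refine Finset.le_sup' g ?_
  exact Finset.mem_filter.2 ⟨Finset.mem_univ i, rfl⟩

theorem exists_apply_eq_cycleMax (d : PermCycles σ) :
    ∃ i, Quotient.mk _ i = d ∧ g i = cycleMax σ g d := by
  rw [cycleMax]
  obtain ⟨i, hi, hmax⟩ := Finset.exists_mem_eq_sup' _ g
  exact ⟨i, (Finset.mem_filter.1 hi).2, hmax.symm⟩

theorem forall_lt_apply_cycleMax_iff {q : X → ℕ} (hq : Antitone q) (w : PermCycles σ → ℕ) :
    (∀ d, w d < q (cycleMax σ g d)) ↔ ∀ i, w (Quotient.mk _ i) < q (g i) := by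
  refine ⟨fun h i => (h (Quotient.mk _ i)).trans_le (hq (apply_le_cycleMax g i)), fun h d => ?_⟩
  obtain ⟨i, rfl, hmax⟩ := exists_apply_eq_cycleMax g d
  exact hmax ▸ h i

end CycleMax

variable {α β γ δ : Type*}

theorem fillingCount_eq_card_pair {r : β → γ} {c : β → δ}
    (hrc : Function.Injective fun x => (r x, c x)) (σ τ : Equiv.Perm α) :
    fillingCount r c σ τ = Nat.card {z : (PermCycles τ → γ) × (PermCycles σ → δ) //
      ∀ i, (z.1 (Quotient.mk _ i), z.2 (Quotient.mk _ i)) ∈ Set.range fun x => (r x, c x)} := by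
  let F : {f : α → β // σ ∈ fiberPerms (c ∘ f) ∧ τ ∈ fiberPerms (r ∘ f)} →
      {z : (PermCycles τ → γ) × (PermCycles σ → δ) //
        ∀ i, (z.1 (Quotient.mk _ i), z.2 (Quotient.mk _ i)) ∈ Set.range fun x => (r x, c x)} :=
    fun f => ⟨((PermCycles.arrowEquiv τ γ).symm ⟨r ∘ f.1, f.2.2⟩,
      (PermCycles.arrowEquiv σ δ).symm ⟨c ∘ f.1, f.2.1⟩), fun i => ⟨f.1 i, rfl⟩⟩
  refine Nat.card_congr (Equiv.ofBijective F ⟨fun f f' h => ?_, fun z => ?_⟩)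
  · have hpair := congrArg Subtype.val h
    exact Subtype.ext (funext fun i => hrc (Prod.ext
      (congrFun (congrArg Prod.fst hpair) (Quotient.mk _ i))
      (congrFun (congrArg Prod.snd hpair) (Quotient.mk _ i))))
  · choose f hf using z.2
    have hr : r ∘ f = PermCycles.arrowEquiv τ γ z.1.1 := funext fun i => congrArg Prod.fst (hf i)
    have hc : c ∘ f = PermCycles.arrowEquiv σ δ z.1.2 := funext fun i => congrArg Prod.snd (hf i)
    refine ⟨⟨f, hc ▸ (PermCycles.arrowEquiv σ δ z.1.2).2,
      hr ▸ (PermCycles.arrowEquiv τ γ z.1.1).2⟩, Subtype.ext (Prod.ext ?_ ?_)⟩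
    · exact (Equiv.symm_apply_eq _).2 (Subtype.ext hr)
    · exact (Equiv.symm_apply_eq _).2 (Subtype.ext hc)

variable [Fintype α] {X : Type*} [LinearOrder X]

theorem card_pair_lt_eq_sum [Fintype γ] (σ τ : Equiv.Perm α) {q : X → ℕ} (hq : Antitone q)
    (b : γ → X) :
    Nat.card {z : (PermCycles τ → γ) × (PermCycles σ → ℕ) //
      ∀ i, z.2 (Quotient.mk _ i) < q (b (z.1 (Quotient.mk _ i)))} =
      ∑ a : PermCycles τ → γ,
        ∏ d : PermCycles σ, q (cycleMax σ (fun i => b (a (Quotient.mk _ i))) d) := by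
  let e (a : PermCycles τ → γ) : {w : PermCycles σ → ℕ //
      ∀ i, w (Quotient.mk _ i) < q (b (a (Quotient.mk _ i)))} ≃
      ∀ d : PermCycles σ, Fin (q (cycleMax σ (fun i => b (a (Quotient.mk _ i))) d)) :=
    ((Equiv.subtypeEquivRight fun w => (forall_lt_apply_cycleMax_iff _ hq w).symm).trans
      (Equiv.subtypePiEquivPi (p := fun d n => n < q (cycleMax σ _ d)))).trans
      (Equiv.piCongrRight fun _ => Fin.equivSubtype.symm)
  rw [Nat.card_congr ((Equiv.subtypeProdEquivSigmaSubtype fun (a : PermCycles τ → γ)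
    (w : PermCycles σ → ℕ) => ∀ i, w (Quotient.mk _ i) < q (b (a (Quotient.mk _ i)))).trans
    (Equiv.sigmaCongrRight e)), Nat.card_sigma]
  simp only [Nat.card_pi, Nat.card_fin]

theorem sum_comp_eq_sum_prod_card_mul {C Y : Type*} [Fintype C] [DecidableEq C] [Fintype γ]
    [Fintype Y] [DecidableEq Y] (b : γ → Y) (F : (C → Y) → ℕ) :
    ∑ a : C → γ, F (b ∘ a) = ∑ g : C → Y, (∏ c, Fintype.card {x // b x = g c}) * F g := by
  rw [← Finset.sum_fiberwise Finset.univ fun a : C → γ => b ∘ a]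
  refine Finset.sum_congr rfl fun g _ => ?_
  rw [Finset.sum_congr rfl fun a ha => by rw [(Finset.mem_filter.1 ha).2], Finset.sum_const,
    smul_eq_mul, ← Fintype.card_pi, ← Fintype.card_subtype]
  exact congrArg (· * F g) (Fintype.card_congr ((Equiv.subtypeEquivRight fun a => funext_iff).trans
    (Equiv.subtypePiEquivPi (p := fun c x => b x = g c))))

variable {m : ℕ} (p q : Fin m → ℕ)

/-- The block of each row of a multirectangular diagram with `p i` rows in the block `i`. -/
def blockList : List (Fin m) := (List.ofFn fun i => List.replicate (p i) i).flatten

theorem multirectList_eq_map_blockList : multirectList p q = (blockList p).map q := by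
  simp only [multirectList, blockList, List.map_flatten, List.map_ofFn, Function.comp_def,
    List.map_replicate]

theorem card_blockList_get_eq (i : Fin m) :
    Fintype.card {r // (blockList p).get r = i} = p i := by
  have hcount : (blockList p).count i = p i := by
    rw [blockList, List.count_flatten, List.map_ofFn, List.sum_ofFn]
    simp [List.count_replicate]
  rw [← hcount, ← Multiset.coe_count, Fintype.card_subtype]
  conv_rhs => rw [← List.ofFn_get (blockList p), ← Fin.univ_val_map, Multiset.count_map]
  simp only [eq_comm]
  rfl

variable {p q}

theorem mem_multirect {hq : Antitone q} {x : ℕ × ℕ} :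
    x ∈ (multirect p q hq).cells ↔
      ∃ h : x.1 < (blockList p).length, x.2 < q ((blockList p).get ⟨x.1, h⟩) := by
  rw [YoungDiagram.mem_cells, multirect, YoungDiagram.mem_ofRowLens]
  simp only [multirectList_eq_map_blockList, List.length_map, List.getElem_map, List.get_eq_getElem]

theorem fillingCount_multirect (σ τ : Equiv.Perm α) (hq : Antitone q) :
    fillingCount (boxRow (multirect p q hq)) (boxCol (multirect p q hq)) σ τ =
      ∑ g : PermCycles τ → Fin m, (∏ c, p (g c)) *
        ∏ d : PermCycles σ, q (cycleMax σ (fun i => g (Quotient.mk _ i)) d) := by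
  let lam := multirect p q hq
  let row : lam.cells → Fin (blockList p).length := fun x => ⟨x.1.1, (mem_multirect.1 x.2).1⟩
  have hrow : fillingCount (boxRow lam) (boxCol lam) σ τ = fillingCount row (boxCol lam) σ τ := by
    simp only [fillingCount, ← fiberPerms_comp_of_injective Fin.val_injective (row ∘ _)]
    rfl
  have hinj : Function.Injective fun x => (row x, boxCol lam x) := fun x y h =>
    Subtype.ext (Prod.ext (Fin.mk.inj (Prod.mk.inj h).1) (Prod.mk.inj h).2)
  have hrange : ∀ (k : Fin (blockList p).length) (j : ℕ),
      (k, j) ∈ Set.range (fun x => (row x, boxCol lam x)) ↔ j < q ((blockList p).get k) := by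
    refine fun k j => ⟨?_, fun h => ⟨⟨(k, j), mem_multirect.2 ⟨k.2, h⟩⟩, rfl⟩⟩
    rintro ⟨x, hx⟩
    obtain ⟨rfl, rfl⟩ := Prod.mk.inj hx
    exact (mem_multirect.1 x.2).2
  rw [hrow, fillingCount_eq_card_pair hinj]
  simp only [hrange, card_pair_lt_eq_sum σ τ hq]
  refine (sum_comp_eq_sum_prod_card_mul (blockList p).get fun g : PermCycles τ → Fin m =>
    ∏ d, q (cycleMax σ (fun i => g (Quotient.mk _ i)) d)).trans ?_
  simp only [card_blockList_get_eq]

end Multirect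

section Polynomials

open MvPolynomial

variable (m : ℕ) {α : Type*} [Fintype α]

/-- The polynomial in the row multiplicities `p` and the row lengths `q` whose value is the number
of fillings of `p × q` compatible with `σ` and `τ`; see `fillingCount`. -/
noncomputable def fillingPolynomial (σ τ : Equiv.Perm α) : MvPolynomial (Fin m ⊕ Fin m) ℂ :=
  ∑ g : PermCycles τ → Fin m, (∏ c, X (Sum.inl (g c))) *
    ∏ d : PermCycles σ, X (Sum.inr (cycleMax σ (fun i => g (Quotient.mk _ i)) d))

theorem eval_fillingPolynomial (σ τ : Equiv.Perm α) (p q : Fin m → ℂ) :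
    eval (Sum.elim p q) (fillingPolynomial m σ τ) = ∑ g : PermCycles τ → Fin m, (∏ c, p (g c)) *
      ∏ d : PermCycles σ, q (cycleMax σ (fun i => g (Quotient.mk _ i)) d) := by
  simp only [fillingPolynomial, map_sum, map_mul, map_prod, eval_X, Sum.elim_inl, Sum.elim_inr]

theorem eval_fillingPolynomial_natCast (σ τ : Equiv.Perm α) (p : Fin m → ℕ) {q : Fin m → ℕ}
    (hq : Antitone q) :
    eval (Sum.elim (fun i => (p i : ℂ)) fun i => (q i : ℂ)) (fillingPolynomial m σ τ) =
      fillingCount (boxRow (multirect p q hq)) (boxCol (multirect p q hq)) σ τ := by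
  rw [eval_fillingPolynomial, fillingCount_multirect]
  push_cast
  rfl

theorem eval_fillingPolynomial_neg (σ τ : Equiv.Perm α) (p q : Fin m → ℂ) :
    eval (Sum.elim p (-q)) (fillingPolynomial m σ τ) =
      (-1) ^ Fintype.card (PermCycles σ) * eval (Sum.elim p q) (fillingPolynomial m σ τ) := by
  simp only [eval_fillingPolynomial, Pi.neg_apply, Finset.prod_neg, Finset.card_univ,
    Finset.mul_sum, mul_left_comm]

variable {l : ℕ} (π : Equiv.Perm (Fin l))

/-- The polynomial `S_π` of the normalized character. -/
noncomputable def characterPolynomial : MvPolynomial (Fin m ⊕ Fin m) ℂ :=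
  ∑ σ : Equiv.Perm (Fin l), C (signChar ℂ (Fin l) σ) * fillingPolynomial m σ (σ⁻¹ * π⁻¹)

/-- The polynomial `M_π` of the moments of the Gaussian random matrix. -/
noncomputable def momentPolynomial : MvPolynomial (Fin m ⊕ Fin m) ℂ :=
  ∑ σ : Equiv.Perm (Fin l), fillingPolynomial m σ (σ⁻¹ * π⁻¹)

theorem isCharacterPolynomial_characterPolynomial :
    IsCharacterPolynomial π (characterPolynomial m π) := fun p q hq _ _ => by
  simp only [characterPolynomial, map_sum, map_mul, eval_C,
    eval_fillingPolynomial_natCast m _ _ p hq, normalizedCharacter_eq_sum_fillingCount]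

theorem isMomentPolynomial_momentPolynomial :
    IsMomentPolynomial π (momentPolynomial m π) := fun p q hq _ _ =>
  ⟨integrable_traceProduct π, by
    simp only [momentPolynomial, map_sum, eval_fillingPolynomial_natCast m _ _ p hq,
      integral_traceProduct]⟩

theorem eval_characterPolynomial (p q : Fin m → ℂ) :
    eval (Sum.elim p q) (characterPolynomial m π) =
      (-1) ^ l * eval (Sum.elim p (-q)) (momentPolynomial m π) := by
  have hsign (σ : Equiv.Perm (Fin l)) :
      signChar ℂ (Fin l) σ = (-1) ^ l * (-1) ^ Fintype.card (PermCycles σ) := by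
    rw [signChar_apply, PermCycles.sign_eq_neg_one_pow, Fintype.card_fin, pow_add]
    push_cast
    rfl
  simp only [characterPolynomial, momentPolynomial, map_sum, map_mul, eval_C,
    eval_fillingPolynomial_neg, hsign, Finset.mul_sum, mul_assoc]

end Polynomials

section Uniqueness

open MvPolynomial

variable {m : ℕ}

theorem mvPolynomial_eq_of_eval_antitone {ι R : Type*} [Finite ι] [CommRing R] [IsDomain R]
    [CharZero R] {P Q : MvPolynomial (ι ⊕ Fin m) R}
    (h : ∀ (p : ι → ℕ) (q : Fin m → ℕ), Antitone q → (∀ i, 0 < p i) → (∀ i, 0 < q i) →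
      eval (Sum.elim (fun i => (p i : R)) fun i => (q i : R)) P =
        eval (Sum.elim (fun i => (p i : R)) fun i => (q i : R)) Q) :
    P = Q := by
  let N := (P - Q).totalDegree + 1
  -- Disjoint intervals of length `N`, placed in decreasing order, make all choices of `q` antitone.
  let start : ι ⊕ Fin m → ℕ := Sum.elim (fun _ => 1) fun i => N * (m - i)
  refine sub_eq_zero.1 (eq_zero_of_eval_zero_at_prod_finset (P - Q)
    (fun x => (Finset.Ico (start x) (start x + N)).map Nat.castEmbedding) (fun x => ?_)
    fun v hv => ?_)
  · rw [Finset.card_map, Nat.card_Ico, Nat.add_sub_cancel_left]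
    exact Nat.lt_succ_of_le (degreeOf_le_totalDegree _ x)
  simp only [Finset.mem_map, Finset.mem_Ico, Nat.castEmbedding_apply] at hv
  choose n hn hnv using hv
  have hstart : ∀ x, 0 < start x := by
    rintro (_ | i)
    · exact one_pos
    · exact Nat.mul_pos (Nat.succ_pos _) (Nat.sub_pos_of_lt i.2)
  have hpos : ∀ x, 0 < n x := fun x => (hstart x).trans_le (hn x).1
  have hanti : StrictAnti fun i => n (Sum.inr i) := fun i j hij =>
    calc n (Sum.inr j) < N * (m - j) + N := (hn (Sum.inr j)).2
      _ = N * (m - j + 1) := (Nat.mul_succ _ _).symm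
      _ ≤ N * (m - i) := Nat.mul_le_mul_left N (by omega)
      _ ≤ n (Sum.inr i) := (hn (Sum.inr i)).1
  have hv : v = Sum.elim (fun i => (n (Sum.inl i) : R)) fun i => (n (Sum.inr i) : R) := by
    funext x
    rcases x with i | i <;> exact (hnv _).symm
  rw [map_sub, sub_eq_zero, hv]
  exact h _ _ hanti.antitone (fun _ => hpos _) fun _ => hpos _

variable {l : ℕ} {π : Equiv.Perm (Fin l)} {P Q : MvPolynomial (Fin m ⊕ Fin m) ℂ}

theorem IsCharacterPolynomial.unique (hP : IsCharacterPolynomial π P)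
    (hQ : IsCharacterPolynomial π Q) : P = Q :=
  mvPolynomial_eq_of_eval_antitone fun p q hq hp hq' =>
    (hP p q hq hp hq').trans (hQ p q hq hp hq').symm

theorem IsMomentPolynomial.unique (hP : IsMomentPolynomial π P) (hQ : IsMomentPolynomial π Q) :
    P = Q :=
  mvPolynomial_eq_of_eval_antitone fun p q hq hp hq' =>
    (hP p q hq hp hq').2.trans (hQ p q hq hp hq').2.symm

end Uniqueness

theorem mainTheorem10 (m l : ℕ) (π : Equiv.Perm (Fin l)) :
    (∃! S : MvPolynomial (Fin m ⊕ Fin m) ℂ, IsCharacterPolynomial π S) ∧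
    (∃! M : MvPolynomial (Fin m ⊕ Fin m) ℂ, IsMomentPolynomial π M) ∧
    ∀ S M : MvPolynomial (Fin m ⊕ Fin m) ℂ,
      IsCharacterPolynomial π S → IsMomentPolynomial π M →
      ∀ p q : Fin m → ℂ,
        MvPolynomial.eval (Sum.elim p q) S =
          (-1) ^ l * MvPolynomial.eval (Sum.elim p (-q)) M := by
  have hS := isCharacterPolynomial_characterPolynomial (m := m) π
  have hM := isMomentPolynomial_momentPolynomial (m := m) π
  refine ⟨⟨_, hS, fun S h => h.unique hS⟩, ⟨_, hM, fun M h => h.unique hM⟩,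
    fun S M h h' p q => ?_⟩
  rw [h.unique hS, h'.unique hM, eval_characterPolynomial]
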